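/- Let $p$ be a prime, $q$ a power of $p$, $C$ a nonsingular projective curve defined over $\mathbb{F}_q$, $\infty$ a closed point of $C$, and $A$ the ring of functions on $C$ that are regular everywhere except possibly at $\infty$. Let $K$ be a field extension of $\mathbb{F}_q$ that is finitely generated as a field and has positive transcendence degree over $\mathbb{F}_p$; fix an algebraic closure $K^{\mathrm{alg}}$ of $K$ and let $\mathbb{F}_p^{\mathrm{alg}}$ be the algebraic closure of $\mathbb{F}_p$ in $K^{\mathrm{alg}}$. Let $K\{\tau\}$ be the ring of polynomials in $\tau$ with coefficients in $K$ and multiplication determined by $\tau c=c^q\tau$ for $c\in K$, and let $i:A\to K$ be a morphism of $\mathbb{F}_q$-algebras. Let $\phi:A\to K\{\tau\}$, $a\mapsto\phi_a$, be a Drinfeld module, that is, a morphism of $\mathbb{F}_q$-algebras such that the coefficient of $\tau^0$ in $\phi_a$ is $i(a)$ for every $a\in A$ and $\phi_a\neq i(a)\tau^0$ for some $a\in A$. For an extension $L$ of $K$ let $\phi(L)$ be the additive group of $L$ with the $A$-module structure in which $a\in A$ with $\phi_a=\sum_n c_n\tau^n$ sends $x$ to $\phi_a(x)=\sum_n c_n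 x^{q^n}$. Suppose that there is a finite subfield of $K$ containing all the coefficients of $\phi_a$ for all $a\in A$. Then $\phi(\mathbb{F}_p^{\mathrm{alg}}K)$, where $\mathbb{F}_p^{\mathrm{alg}}K$ is the compositum inside $K^{\mathrm{alg}}$, is the direct sum of its torsion submodule and a free $A$-submodule of rank $\aleph_0$. Its torsion submodule is infinite and equals $\mathbb{F}_p^{\mathrm{alg}}$, which is also the set of all torsion points of $\phi$ in $K^{\mathrm{alg}}$. -/

import Mathlib

open scoped Cardinal

noncomputable section

/-! ### Nonsingular projective curves over `𝔽_q` and their rings of functions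

A nonsingular projective curve `C` over a field `F` is given by its function field `k`, a finitely
generated extension of `F` of transcendence degree one.  The closed points of `C` are the discrete
valuation rings of `k` over `F` (the local rings of `C`), and the ring of functions regular on an
open set is the intersection of the local rings at the closed points of that set. -/

/-- `k` is the function field of a nonsingular projective curve over `F`. -/
structure IsCurveFunctionField (F k : Type*) [Field F] [Field k] [Algebra F k] : Prop where
  fg : (⊤ : IntermediateField F k).FG
  trdeg_eq_one : Algebra.trdeg F k = 1

/-- A closed point of the nonsingular projective curve over `F` with function field `k`,
given by its local ring, a discrete valuation ring of `k` containing `F`. -/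
structure CurvePoint (F k : Type*) [Field F] [Field k] [Algebra F k] where
  /-- the local ring at the point -/
  localRing : ValuationSubring k
  algebraMap_mem : ∀ c : F, algebraMap F k c ∈ localRing
  isDiscrete : IsDiscreteValuationRing localRing

/-- The functions on the curve that are regular at every closed point of the set `U`. -/
def regularFunctions (F : Type*) {k : Type*} [Field F] [Field k] [Algebra F k]
    (U : Set (CurvePoint F k)) : Subalgebra F k where
  carrier := {f | ∀ P ∈ U, f ∈ P.localRing}
  mul_mem' hf hg P hP := mul_mem (hf P hP) (hg P hP)
  add_mem' hf hg P hP := add_mem (hf P hP) (hg P hP)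
  algebraMap_mem' c P _ := P.algebraMap_mem c

/-- The ring `A` of functions that are regular everywhere except possibly at the point `∞`. -/
abbrev affineRing {F k : Type*} [Field F] [Field k] [Algebra F k] (infty : CurvePoint F k) :
    Subalgebra F k :=
  regularFunctions F {infty}ᶜ

/-! ### Twisted polynomials -/

/-- The action of `ℕ` on `K` by the powers of `x ↦ x ^ q`, where `q` is the number of elements of
the finite field `Fq`. -/
@[reducible] def frobeniusAction (Fq K : Type*) [Field Fq] [Fintype Fq] [Field K] [Algebra Fq K] :
    MulSemiringAction (Multiplicative ℕ) K :=
  MulSemiringAction.compHom K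
    (powersHom (K →+* K) (FiniteField.frobeniusAlgHom Fq K : K →+* K))

/-- The ring `K{τ}` of polynomials in `τ` with coefficients in `K`, where `τ c = c ^ q τ`. -/
def TwistedPolynomial (Fq K : Type*) [Field Fq] [Fintype Fq] [Field K] [Algebra Fq K] : Type _ :=
  SkewPolynomial K

namespace TwistedPolynomial

variable (Fq K : Type*) [Field Fq] [Fintype Fq] [Field K] [Algebra Fq K]

theorem frobeniusAction_smul (n : ℕ) (x : K) :
    (letI := frobeniusAction Fq K; Multiplicative.ofAdd n • x) = x ^ Fintype.card Fq ^ n := by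
  change ((FiniteField.frobeniusAlgHom Fq K : K →+* K) ^ n) x = _
  induction n generalizing x with
  | zero => simp
  | succ n ih =>
    rw [pow_succ, RingHom.mul_def, RingHom.comp_apply, ih]
    simp [pow_succ', pow_mul]

instance : Ring (TwistedPolynomial Fq K) :=
  letI := frobeniusAction Fq K
  inferInstanceAs (Ring (SkewPolynomial K))

variable {Fq K}

/-- The coefficient of `τ ^ n`. -/
def coeff (f : TwistedPolynomial Fq K) (n : ℕ) : K := SkewPolynomial.coeff (R := K) f n

/-- The set of all `n` such that the coefficient of `τ ^ n` is not zero. -/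
def support (f : TwistedPolynomial Fq K) : Finset ℕ := SkewPolynomial.support (R := K) f

/-- The constant twisted polynomials `c τ ^ 0`. -/
def C : K →+* TwistedPolynomial Fq K :=
  letI := frobeniusAction Fq K
  (SkewPolynomial.CRingHom : K →+* SkewPolynomial K)

theorem C_algebraMap_comm (c : Fq) (f : TwistedPolynomial Fq K) :
    C (algebraMap Fq K c) * f = f * C (algebraMap Fq K c) := by
  let _ := frobeniusAction Fq K
  have hc : ∀ n : ℕ, (SkewPolynomial.φ : K →+* K)^[n] (algebraMap Fq K c) = algebraMap Fq K c := by
    intro n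
    rw [SkewPolynomial.φ_iterate_apply]
    refine (frobeniusAction_smul Fq K n _).trans ?_
    rw [← map_pow, FiniteField.pow_card_pow]
  have key : ∀ g : SkewPolynomial K, SkewPolynomial.C (algebraMap Fq K c) * g =
      g * SkewPolynomial.C (algebraMap Fq K c) := by
    intro g
    induction g using SkewPolynomial.induction with
    | h0 => simp
    | ha n r g _ _ ih =>
      rw [mul_add, add_mul, ih, SkewPolynomial.C_mul_monomial, SkewPolynomial.monomial_mul_C, hc,
        mul_comm]
  exact key f

instance : Algebra Fq (TwistedPolynomial Fq K) :=
  (C.comp (algebraMap Fq K)).toAlgebra' fun c f => C_algebraMap_comm c f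

/-- The operator `τ : x ↦ x ^ q` on a field `L`. -/
def tau (Fq L : Type*) [Field Fq] [Fintype Fq] [Field L] [Algebra Fq L] : AddMonoid.End L :=
  (FiniteField.frobeniusAlgHom Fq L : L →+ L)

theorem tau_pow_apply (L : Type*) [Field L] [Algebra Fq L] (n : ℕ) (x : L) :
    (tau Fq L ^ n) x = x ^ Fintype.card Fq ^ n := by
  induction n generalizing x with
  | zero => simp
  | succ n ih =>
    rw [pow_succ]
    change (tau Fq L ^ n) (x ^ Fintype.card Fq) = _
    rw [ih, ← pow_mul, pow_succ']

/-- The twisted polynomials act on every extension `L` of `K`: elements of `K` act by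
multiplication, and `τ` acts by `x ↦ x ^ q`. -/
def eval (L : Type*) [Field L] [Algebra K L] : TwistedPolynomial Fq K →+* AddMonoid.End L :=
  letI := frobeniusAction Fq K
  letI : Algebra Fq L := ((algebraMap K L).comp (algebraMap Fq K)).toAlgebra
  (SkewMonoidAlgebra.liftNCRingHom (Module.toAddMonoidEnd K L)
    (powersHom (AddMonoid.End L) (tau Fq L)) (by
      intro c n
      ext x
      have h := frobeniusAction_smul Fq K n.toAdd c
      simp only [ofAdd_toAdd] at h
      change (n • c) • (tau Fq L ^ n.toAdd) x = (tau Fq L ^ n.toAdd) (c • x)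
      rw [tau_pow_apply, tau_pow_apply, h, smul_pow]) : SkewPolynomial K →+* AddMonoid.End L)

/-- `∑ aₙ τ ^ n` acts by `x ↦ ∑ aₙ x ^ (q ^ n)`. -/
theorem eval_apply (L : Type*) [Field L] [Algebra K L] (f : TwistedPolynomial Fq K) (x : L) :
    eval L f x = ∑ n ∈ f.support,
      algebraMap K L (f.coeff n) * x ^ Fintype.card Fq ^ n := by
  let _ : Algebra Fq L := ((algebraMap K L).comp (algebraMap Fq K)).toAlgebra
  have h : eval L f = ∑ n ∈ f.support, Module.toAddMonoidEnd K L (f.coeff n) * tau Fq L ^ n :=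
    SkewPolynomial.sum_def (R := K) (p := f)
      (fun n c => Module.toAddMonoidEnd K L c * tau Fq L ^ n)
  rw [h]
  refine (AddMonoidHom.finsetSum_apply _ _ _).trans (Finset.sum_congr rfl fun n _ => ?_)
  change f.coeff n • (tau Fq L ^ n) x = _
  rw [tau_pow_apply, Algebra.smul_def]

end TwistedPolynomial

/-! ### Drinfeld modules -/

/-- A Drinfeld module over `K` with respect to the fixed morphism `i : A → K`: a morphism
`φ : A → K{τ}` such that `φ_a` has constant coefficient `i a` for all `a`, and
`φ_a ≠ i a τ ^ 0` for some `a`. -/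
structure DrinfeldModule {Fq A K : Type*} [Field Fq] [Fintype Fq] [CommRing A] [Algebra Fq A]
    [Field K] [Algebra Fq K] (i : A →ₐ[Fq] K) where
  toAlgHom : A →ₐ[Fq] TwistedPolynomial Fq K
  coeff_zero : ∀ a, (toAlgHom a).coeff 0 = i a
  exists_ne : ∃ a, toAlgHom a ≠ TwistedPolynomial.C (i a)

namespace DrinfeldModule

variable {Fq A K : Type*} [Field Fq] [Fintype Fq] [CommRing A] [Algebra Fq A]
  [Field K] [Algebra Fq K] {i : A →ₐ[Fq] K}

/-- All coefficients of all the `φ_a` lie in the subfield `E`. -/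
def IsDefinedOver (φ : DrinfeldModule i) (E : Subfield K) : Prop :=
  ∀ (a : A) (n : ℕ), (φ.toAlgHom a).coeff n ∈ E

/-- `φ(L)`: the additive group of the extension `L` of `K`, with the action of `A` given
by `φ`. -/
def Points (_φ : DrinfeldModule i) (L : Type*) [Field L] [Algebra K L] : Type _ := L

variable (φ : DrinfeldModule i) (L : Type*) [Field L] [Algebra K L]

instance : AddCommGroup (φ.Points L) := inferInstanceAs (AddCommGroup L)

/-- The underlying element of `L` of a point of `φ(L)`. -/
def Points.toField {φ : DrinfeldModule i} {L : Type*} [Field L] [Algebra K L] :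
    φ.Points L ≃+ L := AddEquiv.refl L

instance : Module A (φ.Points L) :=
  letI : Module (AddMonoid.End L) (φ.Points L) := inferInstanceAs (Module (AddMonoid.End L) L)
  Module.compHom (φ.Points L)
    ((TwistedPolynomial.eval L).comp (φ.toAlgHom : A →+* TwistedPolynomial Fq K))

theorem Points.smul_def (a : A) (x : φ.Points L) :
    (a • x).toField = TwistedPolynomial.eval L (φ.toAlgHom a) x.toField := rfl

end DrinfeldModule

/-! ### The fields `𝔽_p^alg` and `𝔽_p^alg K` -/

/-- The algebraic closure of `𝔽_p` inside the algebraic closure `Ω` of `K`. -/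
abbrev fpAlg (p : ℕ) [Fact p.Prime] (Ω : Type*) [Field Ω] [Algebra (ZMod p) Ω] :
    IntermediateField (ZMod p) Ω :=
  algebraicClosure (ZMod p) Ω

/-- The compositum of `𝔽_p^alg` and `K` inside the algebraic closure `Ω` of `K`. -/
abbrev fpAlgCompositum (p : ℕ) [Fact p.Prime] (K Ω : Type*) [Field K] [Field Ω] [Algebra K Ω]
    [Algebra (ZMod p) Ω] : IntermediateField K Ω :=
  IntermediateField.adjoin K (fpAlg p Ω : Set Ω)

end

/-! Write `κ` for `𝔽_p^alg`, `L` for the compositum `κK`, and `E` for a finite subfield of `K` over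
which `φ` is defined.

Torsion (`DrinfeldModule.IsDefinedOver.mem_torsion_iff`): if `a ≠ 0` kills `x`, then `x` is a root
of the nonzero polynomial `φ_a(X)` with coefficients in `E`, so it is algebraic over `𝔽_p`.
Conversely, if `x` is algebraic, then `A x` lies in the finite field `E(x)` while `A` is infinite,
so `a x = b x` for some `a ≠ b`.

Complement: `L` is a left module over `E{τ}`, and `A` acts through `a ↦ φ_a ∈ E{τ}`. The main point
is that `L` is the direct sum of `κ` and a free `E{τ}`-module on a countably infinite set `B`. This
`B` is an `E`-basis of `L` modulo `L^q`, chosen compatibly with a filtration of `L` by pole orders.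
Write `x = s + y^q` with `s` in the span of `B`, and repeat with `y`: taking `q`-th roots divides
pole orders by `q`, so the process ends at functions without poles, which are constants
(`exists_root_filtration`, `exists_basis_mod_range`). A relation among the `τ^n b` is refuted by
reducing it modulo `L^q` and then taking `q`-th roots (`LinearIndepOn.eq_zero_of_sum_iterate_mem`).
The set `B` is infinite because `L / L^q` is a nonzero vector space over the infinite field `L^q`,
whereas `E` is finite.

It remains to see that `E{τ}^(ℕ)` is free over `A`. Division by a nonconstant `φ_t` shows that
`E{τ}` is finitely generated over `𝔽_q[t]`. Since `A` embeds into `E{τ}`, it is finite over `𝔽_q[t]`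
as well, and being integrally closed it is a Dedekind domain. So the torsion-free module `E{τ}` is
projective, and a swindle makes a countable sum of copies of it free
(`nonempty_finsupp_equiv_of_projective`). -/

noncomputable section

open scoped NNReal

/-! ### Places of a rational function field -/

/-- The `π`-adic valuation of a unique factorization domain, with values in the powers of `2`. -/
def primeValuation {B : Type*} [CommRing B] [IsDomain B] [UniqueFactorizationMonoid B]
    (π : B) (hπ : Prime π) : Valuation B ℝ≥0 := by
  classical
  have hfin : ∀ b : B, b ≠ 0 → FiniteMultiplicity π b := fun b hb =>
    FiniteMultiplicity.of_prime_left hπ hb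
  exact
  { toFun := fun b => if b = 0 then 0 else (2⁻¹ : ℝ≥0) ^ multiplicity π b
    map_zero' := if_pos rfl
    map_one' := by
      have : multiplicity π (1 : B) = 0 :=
        multiplicity_eq_zero.2 fun h => hπ.not_isUnit (isUnit_of_dvd_one h)
      simp [this]
    map_mul' := fun a b => by
      by_cases ha : a = 0
      · simp [ha]
      by_cases hb : b = 0
      · simp [hb]
      have hab := mul_ne_zero ha hb
      simp only [ha, hb, hab, if_false]
      rw [multiplicity_mul hπ (hfin _ hab), pow_add]
    map_add_le_max' := fun a b => by
      by_cases ha : a = 0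
      · simp [ha]
      by_cases hb : b = 0
      · simp [hb]
      by_cases hab : a + b = 0
      · simp [hab]
      simp only [ha, hb, hab, if_false]
      have key : min (multiplicity π a) (multiplicity π b) ≤ multiplicity π (a + b) := by
        refine (hfin _ hab).le_multiplicity_of_pow_dvd (dvd_add ?_ ?_)
        · exact (pow_dvd_pow _ (min_le_left _ _)).trans (pow_multiplicity_dvd _ _)
        · exact (pow_dvd_pow _ (min_le_right _ _)).trans (pow_multiplicity_dvd _ _)
      have h2 : (2⁻¹ : ℝ≥0) ≤ 1 := inv_le_one_of_one_le₀ one_le_two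
      refine (pow_le_pow_of_le_one zero_le h2 key).trans ?_
      rcases le_total (multiplicity π a) (multiplicity π b) with h | h
      · rw [min_eq_left h]
        exact le_max_left _ _
      · rw [min_eq_right h]
        exact le_max_right _ _ }

theorem primeValuation_apply {B : Type*} [CommRing B] [IsDomain B] [UniqueFactorizationMonoid B]
    (π : B) (hπ : Prime π) {b : B} (hb : b ≠ 0) :
    primeValuation π hπ b = (2⁻¹ : ℝ≥0) ^ multiplicity π b :=
  if_neg hb

/-- The valuation of a polynomial ring given by the total degree. -/
def degreeValuation (κ ι : Type*) [Field κ] : Valuation (MvPolynomial ι κ) ℝ≥0 := by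
  classical
  exact
  { toFun := fun b => if b = 0 then 0 else (2 : ℝ≥0) ^ b.totalDegree
    map_zero' := if_pos rfl
    map_one' := by simp
    map_mul' := fun a b => by
      by_cases ha : a = 0
      · simp [ha]
      by_cases hb : b = 0
      · simp [hb]
      have hab := mul_ne_zero ha hb
      simp only [ha, hb, hab, if_false]
      rw [MvPolynomial.totalDegree_mul_of_isDomain ha hb, pow_add]
    map_add_le_max' := fun a b => by
      by_cases ha : a = 0
      · simp [ha]
      by_cases hb : b = 0
      · simp [hb]
      by_cases hab : a + b = 0
      · simp [hab]
      simp only [ha, hb, hab, if_false]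
      refine (pow_le_pow_right₀ one_le_two (MvPolynomial.totalDegree_add a b)).trans ?_
      rcases le_total a.totalDegree b.totalDegree with h | h
      · rw [max_eq_right h]
        exact le_max_right _ _
      · rw [max_eq_left h]
        exact le_max_left _ _ }

theorem degreeValuation_apply (κ ι : Type*) [Field κ] {b : MvPolynomial ι κ} (hb : b ≠ 0) :
    degreeValuation κ ι b = (2 : ℝ≥0) ^ b.totalDegree :=
  if_neg hb

/-- A nondegenerate valuation of a domain extends to the field of fractions. -/
theorem Valuation.exists_extension_fractionRing {B : Type*} [CommRing B] [IsDomain B]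
    (v : Valuation B ℝ≥0) (hv : ∀ b, b ≠ 0 → v b ≠ 0) :
    ∃ w : Valuation (FractionRing B) ℝ≥0, ∀ b, w (algebraMap B (FractionRing B) b) = v b := by
  have hS : nonZeroDivisors B ≤ v.supp.primeCompl := fun b hb h =>
    hv b (nonZeroDivisors.ne_zero hb) ((v.mem_supp_iff b).1 h)
  exact ⟨v.extendToLocalization hS (FractionRing B), fun b => by simp⟩

/-- The rational function field has a family of discrete valuations, trivial on the constants, such
that every function has bounded pole orders and the functions without poles are constant. -/
theorem exists_places (κ ι : Type*) [Field κ] :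
    ∃ S : Set (Valuation (FractionRing (MvPolynomial ι κ)) ℝ≥0),
      (∀ v ∈ S, ∀ c : κ, c ≠ 0 → v (algebraMap κ _ c) = 1) ∧
      (∀ v ∈ S, ∀ x, 1 < v x → 2 ≤ v x) ∧
      (∀ x, ∃ C, ∀ v ∈ S, v x ≤ C) ∧
      ∀ x, (∀ v ∈ S, v x ≤ 1) → ∃ c : κ, algebraMap κ _ c = x := by
  classical
  let B := MvPolynomial ι κ
  let F := FractionRing B
  -- These are the prime divisors of affine space and the hyperplane at infinity. All nonzero values
  -- are powers of `2`, which gives the gap between `1` and `2`.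
  let S : Set (Valuation F ℝ≥0) := {w | (∃ π, ∃ hπ : Prime π, ∀ b, w (algebraMap B F b) =
    primeValuation π hπ b) ∨ ∀ b, w (algebraMap B F b) = degreeValuation κ ι b}
  have hprime : ∀ (π : B) (hπ : Prime π), ∃ w ∈ S, ∀ b, w (algebraMap B F b) =
      primeValuation π hπ b := fun π hπ => by
    obtain ⟨w, hw⟩ := (primeValuation π hπ).exists_extension_fractionRing fun b hb => by
      rw [primeValuation_apply _ _ hb]
      positivity
    exact ⟨w, Or.inl ⟨π, hπ, hw⟩, hw⟩
  have hdeg : ∃ w ∈ S, ∀ b, w (algebraMap B F b) = degreeValuation κ ι b := by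
    obtain ⟨w, hw⟩ := (degreeValuation κ ι).exists_extension_fractionRing fun b hb => by
      rw [degreeValuation_apply _ _ hb]
      positivity
    exact ⟨w, Or.inr hw, hw⟩
  have hpow : ∀ v ∈ S, ∀ b : B, b ≠ 0 → ∃ n : ℤ, v (algebraMap B F b) = 2 ^ n := by
    rintro v (⟨π, hπ, h⟩ | h) b hb
    · refine ⟨-(multiplicity π b : ℤ), ?_⟩
      rw [h, primeValuation_apply _ _ hb, zpow_neg, zpow_natCast, inv_pow]
    · exact ⟨b.totalDegree, by rw [h, degreeValuation_apply _ _ hb, zpow_natCast]⟩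
  refine ⟨S, ?_, ?_, ?_, ?_⟩
  · intro v hv c hc
    have hC : (MvPolynomial.C c : B) ≠ 0 := by simpa using hc
    have h1 : algebraMap κ F c = algebraMap B F (MvPolynomial.C c) :=
      IsScalarTower.algebraMap_apply κ B F c
    rw [h1]
    rcases hv with ⟨π, hπ, h⟩ | h
    · have hu : IsUnit (MvPolynomial.C c : B) := (isUnit_iff_ne_zero.2 hc).map MvPolynomial.C
      rw [h, primeValuation_apply _ _ hC, multiplicity_eq_zero.2, pow_zero]
      exact fun hd => hπ.not_isUnit (isUnit_of_dvd_unit hd hu)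
    · rw [h, degreeValuation_apply _ _ hC, MvPolynomial.totalDegree_C, pow_zero]
  · intro v hv x hx
    obtain ⟨a, b, hb, rfl⟩ := IsFractionRing.div_surjective (A := B) x
    have hb0 := nonZeroDivisors.ne_zero hb
    have ha0 : a ≠ 0 := by
      rintro rfl
      simp at hx
    obtain ⟨m, hm⟩ := hpow v hv a ha0
    obtain ⟨n, hn⟩ := hpow v hv b hb0
    rw [map_div₀, hm, hn, ← zpow_sub₀ two_ne_zero] at hx ⊢
    have : 0 < m - n := by
      by_contra! h
      exact absurd hx (not_lt.2 (zpow_le_one_of_nonpos₀ one_le_two h))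
    calc (2 : ℝ≥0) = 2 ^ (1 : ℤ) := (zpow_one _).symm
      _ ≤ _ := zpow_le_zpow_right₀ one_le_two (by lia)
  · intro x
    obtain ⟨a, b, hb, rfl⟩ := IsFractionRing.div_surjective (A := B) x
    have hb0 := nonZeroDivisors.ne_zero hb
    by_cases ha0 : a = 0
    · exact ⟨0, fun v _ => by simp [ha0]⟩
    let _ : NormalizationMonoid B :=
      (UniqueFactorizationMonoid.strongNormalizationMonoid (α := B)).toNormalizationMonoid
    refine ⟨2 ^ ((UniqueFactorizationMonoid.normalizedFactors b).card + a.totalDegree), ?_⟩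
    rintro v (⟨π, hπ, h⟩ | h)
    · rw [map_div₀, h, h, primeValuation_apply _ _ hb0, primeValuation_apply _ _ ha0, inv_pow,
        inv_pow, div_inv_eq_mul]
      -- The bound must not depend on `π`: the number of all prime factors of the denominator serves
      -- every `π` at once.
      have h1 : multiplicity π b ≤ (UniqueFactorizationMonoid.normalizedFactors b).card := by
        refine multiplicity_le_of_emultiplicity_le ?_
        rw [UniqueFactorizationMonoid.emultiplicity_eq_count_normalizedFactors hπ.irreducible hb0]
        exact_mod_cast Multiset.count_le_card _ _
      refine (mul_le_of_le_one_left' (inv_le_one_of_one_le₀ (one_le_pow₀ one_le_two))).trans ?_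
      exact pow_le_pow_right₀ one_le_two (by lia)
    · rw [map_div₀, h, h, degreeValuation_apply _ _ hb0, degreeValuation_apply _ _ ha0]
      refine (div_le_self zero_le (one_le_pow₀ one_le_two)).trans ?_
      exact pow_le_pow_right₀ one_le_two (by lia)
  · intro x hx
    obtain ⟨a, b, hab, rfl⟩ := IsFractionRing.exists_reduced_fraction (A := B) x
    have hb0 : (b : B) ≠ 0 := nonZeroDivisors.ne_zero b.2
    by_cases ha0 : a = 0
    · exact ⟨0, by simp [ha0]⟩
    -- An irreducible factor of the denominator is prime to the numerator, so it would give a pole.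
    -- What is left is a polynomial, and regularity at infinity makes its degree zero.
    have hu : IsUnit (b : B) := by
      by_contra hu
      obtain ⟨π, hπ, hd⟩ := WfDvdMonoid.exists_irreducible_factor hu hb0
      obtain ⟨w, hw, h⟩ := hprime π hπ.prime
      have h1 := hx w hw
      have hna : ¬ π ∣ a := fun h' => hπ.not_isUnit (hab h' hd)
      rw [IsFractionRing.mk'_eq_div, map_div₀, h, h, primeValuation_apply _ _ hb0,
        primeValuation_apply _ _ ha0, multiplicity_eq_zero.2 hna, pow_zero, one_div, inv_pow,
        inv_inv] at h1
      exact absurd h1 (not_le.2 (one_lt_pow₀ one_lt_two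
        (multiplicity_ne_zero.2 hd)))
    obtain ⟨u, hu⟩ := hu
    obtain ⟨f, hf⟩ : ∃ f : B, algebraMap B F f = IsLocalization.mk' F a b := by
      refine ⟨a * (↑u⁻¹ : B), ?_⟩
      rw [IsLocalization.eq_mk'_iff_mul_eq, ← map_mul, mul_assoc, ← hu, Units.inv_mul, mul_one]
    obtain ⟨w, hw, h⟩ := hdeg
    have h1 := hx w hw
    rw [← hf] at h1 ⊢
    by_cases hf0 : f = 0
    · exact ⟨0, by simp [hf0]⟩
    rw [h, degreeValuation_apply _ _ hf0] at h1
    have h2 : f.totalDegree = 0 := by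
      by_contra h0
      exact absurd h1 (not_le.2 (one_lt_pow₀ one_lt_two h0))
    refine ⟨f.coeff 0, ?_⟩
    rw [IsScalarTower.algebraMap_apply κ B F]
    congr 1
    exact (MvPolynomial.totalDegree_eq_zero_iff_eq_C.1 h2).symm

/-! ### Filtration of a function field by pole orders -/

/-- A valuation of a field `F` with real values extends to a power-multiplicative nonarchimedean
function on an algebraic extension, controlled by the coefficients of minimal polynomials. -/
theorem exists_spectral_extension {F L : Type*} [Field F] [Field L] [Algebra F L]
    [Algebra.IsAlgebraic F L] (v : Valuation F ℝ≥0) :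
    ∃ h : L → ℝ, (∀ x, 0 ≤ h x) ∧ (∀ x y, h (x + y) ≤ max (h x) (h y)) ∧
      (∀ x n, 1 ≤ n → h (x ^ n) = h x ^ n) ∧ (∀ (c : F) x, h (c • x) = v c * h x) ∧
      (∀ x i, i < (minpoly F x).natDegree →
        (v ((minpoly F x).coeff i) : ℝ) ≤ h x ^ ((minpoly F x).natDegree - i)) ∧
      ∀ x (C : ℝ), 1 ≤ C → (∀ i, (v ((minpoly F x).coeff i) : ℝ) ≤ C) → h x ≤ C := by
  let a : AbsoluteValue F ℝ :=
    { toFun := fun x => v x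
      map_mul' := fun x y => by simp
      nonneg' := fun x => NNReal.coe_nonneg _
      eq_zero' := fun x => by simp
      add_le' := fun x y => by
        have h := v.map_add x y
        exact_mod_cast h.trans (max_le_add_of_nonneg zero_le zero_le) }
  let _ : NormedField F := a.toNormedField
  have hn : ∀ x : F, ‖x‖ = v x := fun x => rfl
  have _ : IsUltrametricDist F :=
    IsUltrametricDist.isUltrametricDist_of_isNonarchimedean_norm fun x y => by
      rw [hn, hn, hn]
      exact_mod_cast v.map_add x y
  -- The spectral norm is the supremum of `|a_i| ^ (1 / (d - i))` over the coefficients `a_i` of the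
  -- minimal polynomial of degree `d`, so the last two bounds are read off termwise. As `F` need not
  -- be complete, multiplicativity is claimed only for powers and for scalars from `F`.
  refine ⟨spectralNorm F L, spectralNorm_nonneg, isNonarchimedean_spectralNorm,
    fun x n hn => isPowMul_spectralNorm x hn, fun c x => ?_, fun x i hi => ?_, fun x C hC hi => ?_⟩
  · rw [spectralNorm_smul c (Algebra.IsAlgebraic.isAlgebraic x)]
    rfl
  · have h1 : spectralValueTerms (minpoly F x) i ≤ spectralNorm F L x :=
      le_ciSup (spectralValueTerms_bddAbove _) i
    rw [spectralValueTerms_of_lt_natDegree _ hi, hn] at h1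
    have h2 : (0 : ℝ) < ((minpoly F x).natDegree - i : ℕ) := by
      exact_mod_cast Nat.sub_pos_of_lt hi
    rw [← Nat.cast_sub hi.le, one_div, Real.rpow_inv_le_iff_of_pos (NNReal.coe_nonneg _)
      (spectralNorm_nonneg _) h2, Real.rpow_natCast] at h1
    exact h1
  · refine ciSup_le fun i => ?_
    rcases lt_or_ge i (minpoly F x).natDegree with h | h
    · rw [spectralValueTerms_of_lt_natDegree _ h, hn]
      have h2 : (1 : ℝ) ≤ ((minpoly F x).natDegree - i : ℕ) := by
        exact_mod_cast Nat.sub_pos_of_lt h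
      have h3 : 0 < 1 / (((minpoly F x).natDegree - i : ℕ) : ℝ) := by positivity
      rw [← Nat.cast_sub h.le]
      refine (Real.rpow_le_rpow (NNReal.coe_nonneg _) (hi i) h3.le).trans ?_
      calc C ^ (1 / (((minpoly F x).natDegree - i : ℕ) : ℝ)) ≤ C ^ (1 : ℝ) :=
            Real.rpow_le_rpow_of_exponent_le hC ((div_le_one (by linarith)).2 h2)
        _ = C := Real.rpow_one C
    · rw [spectralValueTerms_of_natDegree_le _ h]
      linarith

/-- A finitely generated field extension is finite over a rational function field. -/
theorem exists_finite_over_rational (κ L : Type*) [Field κ] [Field L] [Algebra κ L]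
    [Algebra.EssFiniteType κ L] :
    ∃ (ι : Set L) (_ : Algebra (FractionRing (MvPolynomial ι κ)) L),
      IsScalarTower κ (FractionRing (MvPolynomial ι κ)) L ∧
      Module.Finite (FractionRing (MvPolynomial ι κ)) L := by
  obtain ⟨s, hs⟩ := exists_isTranscendenceBasis κ L
  let B := MvPolynomial s κ
  let F := FractionRing B
  let f : F →ₐ[κ] L := IsFractionRing.liftAlgHom (g := MvPolynomial.aeval ((↑) : s → L)) hs.1
  let _ : Algebra F L := f.toAlgebra
  have ht : IsScalarTower κ F L := IsScalarTower.of_algebraMap_eq fun x => (f.commutes x).symm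
  have halg : Algebra.IsAlgebraic F L := by
    have := hs.isAlgebraic
    let e : Algebra.adjoin κ (Set.range ((↑) : s → L)) →+* F :=
      (algebraMap B F).comp hs.1.aevalEquiv.symm.toRingEquiv.toRingHom
    refine Algebra.IsAlgebraic.ringHom_of_comp_eq (R := Algebra.adjoin κ (Set.range ((↑) : s → L)))
      (A := L) e (RingHom.id L) ?_ Function.surjective_id ?_
    · exact (IsFractionRing.injective B F).comp (hs.1.aevalEquiv.symm.injective)
    · ext x
      obtain ⟨b, rfl⟩ := hs.1.aevalEquiv.surjective x
      have h1 : e (hs.1.aevalEquiv b) = algebraMap B F b :=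
        congrArg (algebraMap B F) (hs.1.aevalEquiv.symm_apply_apply b)
      change f (e (hs.1.aevalEquiv b)) = _
      rw [h1]
      refine (IsFractionRing.lift_algebraMap
        (g := (MvPolynomial.aeval ((↑) : s → L) : B →ₐ[κ] L).toRingHom) hs.1 b).trans ?_
      exact (hs.1.algebraMap_aevalEquiv b).symm
  have := Algebra.EssFiniteType.of_comp κ F L
  exact ⟨s, _, ht, Algebra.finite_of_essFiniteType_of_isAlgebraic⟩

/-- If a field `F` has a family of discrete valuations that are trivial on `κ`, such that the
elements of `F` have bounded pole orders and those without poles lie in `κ`, then a finite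
extension of `F` in which `κ` is algebraically closed has a filtration by pole orders. -/
theorem exists_root_filtration_of_places {κ F L : Type*} [Field κ] [Field F] [Field L]
    [Algebra κ L] [Algebra κ F] [Algebra F L] [IsScalarTower κ F L] [Module.Finite F L]
    (S : Set (Valuation F ℝ≥0)) (hS1 : ∀ v ∈ S, ∀ c : κ, c ≠ 0 → v (algebraMap κ F c) = 1)
    (hS2 : ∀ v ∈ S, ∀ x, 1 < v x → 2 ≤ v x) (hS3 : ∀ x, ∃ C, ∀ v ∈ S, v x ≤ C)
    (hS4 : ∀ x, (∀ v ∈ S, v x ≤ 1) → ∃ c : κ, algebraMap κ F c = x)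
    (hκ : ∀ x : L, IsAlgebraic κ x → x ∈ (algebraMap κ L).range) {q : ℕ} (hq : 2 ≤ q) :
    ∃ V : ℕ → Submodule κ L, Monotone V ∧ (∀ x, ∃ n, x ∈ V n) ∧
      (∀ x ∈ V 0, x ∈ (algebraMap κ L).range) ∧ ∀ n y, y ^ q ∈ V (n + 1) → y ∈ V n := by
  have _ : Algebra.IsAlgebraic F L := Algebra.IsAlgebraic.of_finite F L
  choose h h0 hadd hpow hsmul hle hC using
    fun v : Valuation F ℝ≥0 => exists_spectral_extension (L := L) v
  let N := Module.finrank F L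
  have hN : ∀ x : L, (minpoly F x).natDegree ≤ N := fun x => minpoly.natDegree_le x
  have hN0 : N ≠ 0 := (Module.finrank_pos (R := F) (M := L)).ne'
  have hzero : ∀ v, h v 0 = 0 := fun v => by simpa using hsmul v 0 0
  -- The bound `2 ^ q ^ n` is made so that `y ↦ y ^ q` shifts the index by exactly one. The exponent
  -- `N = [L : F]` and the strict inequality are there for `V 0`, where they force the coefficients
  -- of the minimal polynomial to have values below `2`.
  let V : ℕ → Submodule κ L := fun n =>
    { carrier := {x | ∀ v ∈ S, h v x ^ N < 2 ^ q ^ n}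
      zero_mem' := fun v _ => by
        rw [hzero, zero_pow hN0]
        positivity
      add_mem' := fun {x y} hx hy v hv => by
        refine (pow_le_pow_left₀ (h0 v _) (hadd v x y) N).trans_lt ?_
        rcases le_total (h v x) (h v y) with hxy | hxy
        · rw [max_eq_right hxy]
          exact hy v hv
        · rw [max_eq_left hxy]
          exact hx v hv
      smul_mem' := fun c x hx v hv => by
        have h1 : c • x = algebraMap κ F c • x := (algebraMap_smul F c x).symm
        rw [h1, hsmul]
        by_cases hc : c = 0
        · rw [hc, map_zero, map_zero, NNReal.coe_zero, zero_mul, zero_pow hN0]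
          positivity
        · rw [hS1 v hv c hc, NNReal.coe_one, one_mul]
          exact hx v hv }
  have hVmem : ∀ n x, x ∈ V n ↔ ∀ v ∈ S, h v x ^ N < 2 ^ q ^ n := fun n x => Iff.rfl
  refine ⟨V, ?_, ?_, ?_, ?_⟩
  · intro m n hmn x hx v hv
    exact (hx v hv).trans_le (pow_le_pow_right₀ one_le_two (Nat.pow_le_pow_right (by lia) hmn))
  · intro x
    choose C hCx using hS3
    let D : ℝ≥0 := 1 + ∑ i ∈ (minpoly F x).support, C ((minpoly F x).coeff i)
    have hD : ∀ v ∈ S, h v x ≤ D := fun v hv => by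
      refine hC v x D (by exact_mod_cast le_add_of_nonneg_right zero_le) fun i => ?_
      by_cases hi : i ∈ (minpoly F x).support
      · have h1 : C ((minpoly F x).coeff i) ≤ ∑ i ∈ (minpoly F x).support, C ((minpoly F x).coeff i) :=
          Finset.single_le_sum (f := fun i => C ((minpoly F x).coeff i)) (fun _ _ => zero_le) hi
        exact_mod_cast (hCx _ v hv).trans (h1.trans (le_add_of_nonneg_left zero_le))
      · rw [Polynomial.notMem_support_iff.1 hi, map_zero]
        exact NNReal.coe_nonneg _
    obtain ⟨n, hn⟩ := pow_unbounded_of_one_lt ((D : ℝ) ^ N) one_lt_two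
    refine ⟨n, fun v hv => ?_⟩
    refine (pow_le_pow_left₀ (h0 v _) (hD v hv) N).trans_lt (hn.trans_le ?_)
    exact pow_le_pow_right₀ one_le_two (Nat.lt_pow_self (by lia)).le
  · intro x hx
    refine hκ x ?_
    -- A pole of the `i`-th coefficient would give `2 ≤ v (a_i) ≤ h ^ (d - i) ≤ h ^ N < 2`.
    have hx0 : ∀ v ∈ S, ∀ i, v ((minpoly F x).coeff i) ≤ 1 := by
      intro v hv i
      by_contra! hlt
      have hmon : (minpoly F x).Monic := minpoly.monic (Algebra.IsIntegral.isIntegral x)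
      rcases lt_trichotomy i (minpoly F x).natDegree with hi | hi | hi
      · have h1 := hle v x i hi
        have h2 : (2 : ℝ) ≤ v ((minpoly F x).coeff i) := by exact_mod_cast hS2 v hv _ hlt
        have h3 := h2.trans h1
        have h4 : 1 ≤ h v x := by
          by_contra! h5
          have := pow_le_one₀ (n := (minpoly F x).natDegree - i) (h0 v x) h5.le
          linarith
        have h5 := pow_le_pow_right₀ h4 ((Nat.sub_le (minpoly F x).natDegree i).trans (hN x))
        have h6 := hx v hv
        simp only [pow_zero, pow_one] at h6
        linarith
      · rw [hi, hmon.coeff_natDegree, map_one] at hlt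
        exact lt_irrefl _ hlt
      · rw [Polynomial.coeff_eq_zero_of_natDegree_lt hi, map_zero] at hlt
        exact absurd hlt (not_lt.2 zero_le)
    have hlift : minpoly F x ∈ Polynomial.lifts (algebraMap κ F) := by
      rw [Polynomial.lifts_iff_coeff_lifts]
      intro i
      obtain ⟨c, hc⟩ := hS4 _ fun v hv => hx0 v hv i
      exact ⟨c, hc⟩
    obtain ⟨g, hg⟩ := hlift
    refine ⟨g, ?_, ?_⟩
    · rintro rfl
      have : minpoly F x ≠ 0 := minpoly.ne_zero (Algebra.IsIntegral.isIntegral x)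
      exact this (by rw [← hg]; simp)
    · rw [← Polynomial.aeval_map_algebraMap F]
      have : Polynomial.map (algebraMap κ F) g = minpoly F x := hg
      rw [this, minpoly.aeval]
  · intro n y hy v hv
    have h1 := hy v hv
    rw [hpow v y q (by lia), ← pow_mul, mul_comm q N, pow_mul, pow_succ q n, pow_mul] at h1
    exact lt_of_pow_lt_pow_left₀ q (by positivity) h1

/-- A finitely generated extension `L` of an algebraically closed subfield `κ` is exhausted by an
increasing sequence of `κ`-subspaces, starting inside `κ`, such that the index goes down
when `q`-th roots are taken. -/
theorem exists_root_filtration {κ L : Type*} [Field κ] [Field L] [Algebra κ L]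
    [Algebra.EssFiniteType κ L] (hκ : ∀ x : L, IsAlgebraic κ x → x ∈ (algebraMap κ L).range)
    {q : ℕ} (hq : 2 ≤ q) :
    ∃ V : ℕ → Submodule κ L, Monotone V ∧ (∀ x, ∃ n, x ∈ V n) ∧
      (∀ x ∈ V 0, x ∈ (algebraMap κ L).range) ∧ ∀ n y, y ^ q ∈ V (n + 1) → y ∈ V n := by
  obtain ⟨ι, _, _, _⟩ := exists_finite_over_rational κ L
  obtain ⟨S, hS1, hS2, hS3, hS4⟩ := exists_places κ ι
  exact exists_root_filtration_of_places S hS1 hS2 hS3 hS4 hκ hq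

/-! ### Bases of a field modulo the image of an endomorphism -/

section RootBasis

variable {E L : Type*} [Field E] [Field L] [Algebra E L] (σ : L →+* L)

/-- The image of an endomorphism `σ` of a field `L`, as a subspace over a subfield `E` that is
mapped onto itself. -/
def rangeSubspace (hσ : ∀ e : E, ∃ e' : E, σ (algebraMap E L e') = algebraMap E L e) :
    Submodule E L where
  carrier := Set.range σ
  zero_mem' := ⟨0, map_zero σ⟩
  add_mem' := by
    rintro _ _ ⟨x, rfl⟩ ⟨y, rfl⟩
    exact ⟨x + y, map_add σ x y⟩
  smul_mem' := by
    rintro e _ ⟨x, rfl⟩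
    obtain ⟨e', he'⟩ := hσ e
    exact ⟨algebraMap E L e' * x, by rw [map_mul, he', Algebra.smul_def]⟩

/-- Given a filtration whose index goes down when preimages under `σ` are taken, a basis of `L`
modulo `σ L` can be chosen compatibly with the filtration, and then it generates `L` under `σ`. -/
theorem exists_basis_mod_range (hσ : ∀ e : E, ∃ e' : E, σ (algebraMap E L e') = algebraMap E L e)
    (V : ℕ → Submodule E L) (hmono : Monotone V) (hex : ∀ x, ∃ n, x ∈ V n)
    (hV : ∀ n y, σ y ∈ V (n + 1) → y ∈ V n) :
    ∃ B : Set L, LinearIndepOn E (rangeSubspace σ hσ).mkQ B ∧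
      ∀ M : AddSubgroup L, (V 0 : Set L) ⊆ M → (∀ y ∈ M, σ y ∈ M) →
        (∀ (e : E), ∀ b ∈ B, e • b ∈ M) → M = ⊤ := by
  set I := rangeSubspace σ hσ
  let G := {b : ℕ × Set L // b.2 ⊆ V b.1 ∧ LinearIndepOn E I.mkQ b.2}
  have hstep : ∀ g : G, ∃ g' : G, g'.1.1 = g.1.1 + 1 ∧ g.1.2 ⊆ g'.1.2 ∧
      I.mkQ '' (V (g.1.1 + 1)) ⊆ Submodule.span E (I.mkQ '' g'.1.2) := by
    rintro ⟨⟨n, b⟩, hb1, hb2⟩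
    obtain ⟨b', h1, h2, h3, h4⟩ := exists_linearIndepOn_extension hb2
      (hb1.trans (SetLike.coe_subset_coe.2 (hmono n.le_succ)))
    exact ⟨⟨⟨n + 1, b'⟩, h1, h4⟩, rfl, h2, h3⟩
  choose next hn1 hn2 hn3 using hstep
  let g : ℕ → G := fun n => Nat.rec ⟨⟨0, ∅⟩, Set.empty_subset _, linearIndepOn_empty _ _⟩
    (fun _ => next) n
  have hg : ∀ n, g (n + 1) = next (g n) := fun n => rfl
  have hg1 : ∀ n, (g n).1.1 = n := by
    intro n
    induction n with
    | zero => rfl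
    | succ n ih => rw [hg, hn1, ih]
  have hgmono : Monotone fun n => (g n).1.2 :=
    monotone_nat_of_le_succ fun n => hn2 (g n)
  refine ⟨⋃ n, (g n).1.2, linearIndepOn_iUnion_of_directed hgmono.directed_le
    fun n => (g n).2.2, fun M hM0 hMσ hMB => ?_⟩
  -- `M` is only an additive group, but the `E`-span of `B` is additively generated by the
  -- `E`-multiples of elements of `B`.
  have hMspan : ∀ x ∈ Submodule.span E (⋃ n, (g n).1.2), x ∈ M := by
    intro x hx
    induction hx using Submodule.closure_induction with
    | zero => exact M.zero_mem
    | add x y _ _ hx hy => exact M.add_mem hx hy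
    | smul_mem e b hb => exact hMB e b hb
  have key : ∀ n, ∀ x ∈ V n, x ∈ M := by
    intro n
    induction n with
    | zero => exact fun x hx => hM0 hx
    | succ n ih =>
      intro x hx
      have h1 : I.mkQ x ∈ Submodule.span E (I.mkQ '' (g (n + 1)).1.2) := by
        refine hn3 (g n) ⟨x, ?_, rfl⟩
        rw [hg1]
        exact hx
      rw [Submodule.span_image] at h1
      obtain ⟨s, hs, hsx⟩ := h1
      have h2 : x - s ∈ I := by
        rw [← Submodule.Quotient.mk_eq_zero, Submodule.Quotient.mk_sub, sub_eq_zero]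
        exact hsx.symm
      obtain ⟨y, hy⟩ := h2
      -- This is what compatibility with the filtration buys: `s` lies in the same step as `x`, so
      -- `σ y = x - s` does too, and `y` drops to `V n`.
      have hsV : s ∈ V (n + 1) := by
        refine Submodule.span_le.2 ?_ hs
        exact fun z hz => (congrArg (fun m => z ∈ V m) (hg1 (n + 1))).mp ((g (n + 1)).2.1 hz)
      have h3 : y ∈ V n := hV n y (by
        rw [hy]
        exact sub_mem hx hsV)
      have h4 : x = σ y + s := by rw [hy, sub_add_cancel]
      rw [h4]
      refine M.add_mem (hMσ _ (ih y h3)) (hMspan s ?_)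
      exact Submodule.span_mono (Set.subset_iUnion (fun n => (g n).1.2) (n + 1)) hs
  refine eq_top_iff.2 fun x _ => ?_
  obtain ⟨n, hn⟩ := hex x
  exact key n x hn

/-- The images under the iterates of `σ` of elements that are independent modulo `σ L` are
independent modulo every subspace of `σ L` that is stable under `σ⁻¹`. -/
theorem LinearIndepOn.eq_zero_of_sum_iterate_mem
    {hσ : ∀ e : E, ∃ e' : E, σ (algebraMap E L e') = algebraMap E L e}
    {B : Set L} (hB : LinearIndepOn E (rangeSubspace σ hσ).mkQ B)
    (κ : Set L) (hκσ : κ ⊆ Set.range σ) (hκ : ∀ y, σ y ∈ κ → y ∈ κ)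
    {s : Finset L} (hs : (s : Set L) ⊆ B) (m : ℕ) (c : L → ℕ → E)
    (hc : ∑ b ∈ s, ∑ n ∈ Finset.range m, c b n • (σ^[n] b) ∈ κ) :
    ∀ b ∈ s, ∀ n < m, c b n = 0 := by
  induction m generalizing c with
  | zero => exact fun b _ n hn => absurd hn (Nat.not_lt_zero n)
  | succ m ih =>
    have hσ' := hσ
    choose ψ hψ using hσ'
    -- The terms with `n ≥ 1` are `σ` of a shorter sum, where `ψ` undoes `σ` on coefficients. Modulo
    -- `σ L` these terms and `κ` vanish, so independence kills the coefficients `c b 0`; then `σ` is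
    -- cancelled, which keeps the sum in `κ`.
    have h1 : ∑ b ∈ s, ∑ n ∈ Finset.range (m + 1), c b n • (σ^[n] b) =
        σ (∑ b ∈ s, ∑ n ∈ Finset.range m, ψ (c b (n + 1)) • (σ^[n] b)) + ∑ b ∈ s, c b 0 • b := by
      simp only [Finset.sum_range_succ', Finset.sum_add_distrib, map_sum, Algebra.smul_def, map_mul,
        hψ, Function.iterate_succ_apply', Function.iterate_zero, id]
    rw [h1] at hc
    have h2 : ∑ b ∈ s, c b 0 • b ∈ rangeSubspace σ hσ := by
      obtain ⟨y, hy⟩ := hκσ hc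
      refine ⟨y - ∑ b ∈ s, ∑ n ∈ Finset.range m, ψ (c b (n + 1)) • (σ^[n] b), ?_⟩
      rw [map_sub, hy, add_sub_cancel_left]
    have h3 : ∀ b ∈ s, c b 0 = 0 := by
      refine linearIndepOn_finset_iff.1 (hB.mono hs) (fun b => c b 0) ?_
      rw [← (Submodule.Quotient.mk_eq_zero _).2 h2]
      exact (map_sum (rangeSubspace σ hσ).mkQ (fun b => c b 0 • b) s).symm
    have h4 : ∑ b ∈ s, c b 0 • b = 0 :=
      Finset.sum_eq_zero fun b hb => by rw [h3 b hb, zero_smul]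
    rw [h4, add_zero] at hc
    have h5 := ih _ (hκ _ hc)
    intro b hb n hn
    rcases n with _ | n
    · exact h3 b hb
    · have h6 := hψ (c b (n + 1))
      rw [h5 b hb n (by lia), map_zero, map_zero] at h6
      exact (algebraMap E L).injective (by rw [← h6, map_zero])

/-- If `E` is finite and `L` is infinite, then a basis of `L` modulo `σ L` over `E` is empty or
infinite. -/
theorem LinearIndepOn.infinite_of_nonempty [Finite E]
    {hσ : ∀ e : E, ∃ e' : E, σ (algebraMap E L e') = algebraMap E L e}
    {B : Set L} (hB : LinearIndepOn E (rangeSubspace σ hσ).mkQ B)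
    (hspan : ∀ x, x ∈ rangeSubspace σ hσ ⊔ Submodule.span E B) (hne : B.Nonempty)
    (hinf : (Set.range σ).Infinite) : B.Infinite := by
  intro hfin
  set I := rangeSubspace σ hσ
  obtain ⟨b, hb⟩ := hne
  have hbI : b ∉ I := fun h => hB.ne_zero hb ((Submodule.Quotient.mk_eq_zero _).2 h)
  have h1 : Finite (Submodule.span E B) := by
    have := hfin.to_subtype
    have : Module.Finite E (Submodule.span E B) := Module.Finite.span_of_finite E hfin
    exact Module.finite_of_finite E
  have h2 : Function.Surjective fun x : Submodule.span E B => I.mkQ x := by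
    intro y
    obtain ⟨x, rfl⟩ := I.mkQ_surjective y
    obtain ⟨i, hi, z, hz, rfl⟩ := Submodule.mem_sup.1 (hspan x)
    refine ⟨⟨z, hz⟩, ?_⟩
    rw [map_add, show I.mkQ i = 0 from (Submodule.Quotient.mk_eq_zero _).2 hi, zero_add]
  have h3 : Finite (L ⧸ I) := Finite.of_surjective _ h2
  -- As `σ L` is a field, `u * b ∈ σ L` with `0 ≠ u ∈ σ L` would give `b ∈ σ L`. So the multiples of
  -- `b` by `σ L` are already infinitely many classes in the quotient.
  have h4 : Set.InjOn (fun c => I.mkQ (c * b)) (Set.range σ) := by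
    rintro _ ⟨c, rfl⟩ _ ⟨d, rfl⟩ h
    by_contra hne
    have h5 : (σ c - σ d) * b ∈ I := by
      rw [← Submodule.Quotient.mk_eq_zero, sub_mul, Submodule.Quotient.mk_sub, sub_eq_zero]
      exact h
    obtain ⟨y, hy⟩ := h5
    refine hbI ⟨y / (c - d), ?_⟩
    rw [map_div₀, hy, map_sub, mul_div_cancel_left₀ _ (sub_ne_zero.2 hne)]
  exact hinf (Set.Finite.of_finite_image (Set.toFinite _) h4)

end RootBasis

/-! ### The swindle for projective modules -/

section Swindle

variable {A : Type*} [CommRing A]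

/-- Finitely supported functions with values in a product. -/
def finsuppProdValuesEquiv (ι A M N : Type*) [CommRing A] [AddCommGroup M] [Module A M]
    [AddCommGroup N] [Module A N] : (ι →₀ M × N) ≃ₗ[A] (ι →₀ M) × (ι →₀ N) :=
  LinearEquiv.ofLinearMap
    ((Finsupp.mapRange.linearMap (LinearMap.fst A M N)).prod
      (Finsupp.mapRange.linearMap (LinearMap.snd A M N)))
    ((Finsupp.mapRange.linearMap (LinearMap.inl A M N)).coprod
      (Finsupp.mapRange.linearMap (LinearMap.inr A M N)))
    (by
      refine LinearMap.ext fun f => Prod.ext (Finsupp.ext fun i => ?_) (Finsupp.ext fun i => ?_) <;>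
      simp)
    (by
      refine LinearMap.ext fun f => Finsupp.ext fun i => Prod.ext ?_ ?_ <;> simp)

/-- A surjection onto a projective module splits. -/
theorem LinearMap.nonempty_equiv_ker_prod {M N : Type*} [AddCommGroup M] [Module A M]
    [AddCommGroup N] [Module A N] [Module.Projective A N] (f : M →ₗ[A] N)
    (hf : Function.Surjective f) : Nonempty (M ≃ₗ[A] LinearMap.ker f × N) := by
  obtain ⟨l, hl⟩ := f.exists_rightInverse_of_surjective (LinearMap.range_eq_top.2 hf)
  exact ⟨((LinearMap.exact_subtype_ker_map f).splitSurjectiveEquiv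
    (Submodule.injective_subtype _) ⟨l, hl⟩).1⟩

/-- A finitely generated projective nonzero module over a domain is a generator. -/
theorem exists_surjective_of_projective [IsDomain A] (P : Type*) [AddCommGroup P] [Module A P]
    [Module.Finite A P] [Module.Projective A P] [Nontrivial P] :
    ∃ f : (ℕ →₀ P) →ₗ[A] A, Function.Surjective f := by
  -- `T` is the trace ideal. A splitting of the free cover gives `T P = P`, and Nakayama yields `r ≡
  -- 1` modulo `T` that kills `P`. As `P` is nonzero and torsion-free, `r = 0` and `T = A`.
  let T : Ideal A := ⨆ f : P →ₗ[A] A, LinearMap.range f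
  have hTP : (⊤ : Submodule A P) ≤ T • ⊤ := by
    intro x _
    obtain ⟨s, hs⟩ := (Module.projective_def' (R := A) (P := P)).1 inferInstance
    have h1 : Finsupp.linearCombination A id (s x) = x := LinearMap.congr_fun hs x
    rw [← h1, Finsupp.linearCombination_apply]
    refine Submodule.sum_mem _ fun i _ => Submodule.smul_mem_smul ?_ trivial
    exact Submodule.mem_iSup_of_mem ((Finsupp.lapply i).comp s) ⟨x, rfl⟩
  obtain ⟨r, hr, hrP⟩ := Submodule.exists_sub_one_mem_and_smul_eq_zero_of_fg_of_le_smul T ⊤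
    Module.Finite.fg_top hTP
  obtain ⟨x, hx⟩ := exists_ne (0 : P)
  have hr0 : r = 0 := (smul_eq_zero.1 (hrP x trivial)).resolve_right hx
  have h1 : (1 : A) ∈ T := by simpa [hr0] using hr
  obtain ⟨c, hc⟩ : ∃ c : (P →ₗ[A] A) →₀ P, c.sum (fun f y => f y) = 1 := by
    obtain ⟨c, hc, hc'⟩ := (Submodule.mem_iSup_iff_exists_finsupp _ _).1 h1
    choose y hy using hc
    classical
    refine ⟨Finsupp.onFinset c.support (fun f => if c f = 0 then 0 else y f) fun f hf => ?_, ?_⟩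
    · rw [Finsupp.mem_support_iff]
      intro h0
      simp [h0] at hf
    · rw [Finsupp.onFinset_sum _ fun f => map_zero f, ← hc']
      refine Finset.sum_congr rfl fun f hf => ?_
      simp only
      rw [if_neg (Finsupp.mem_support_iff.1 hf), hy]
  let e := c.support.equivFin
  -- The finitely many functionals in an expression of `1` act on separate copies of `P`; the other
  -- copies go to zero.
  let g : (ℕ →₀ P) →ₗ[A] A := Finsupp.lsum A fun n =>
    if h : n < c.support.card then (e.symm ⟨n, h⟩ : P →ₗ[A] A) else 0
  refine ⟨g, ?_⟩
  rw [← LinearMap.range_eq_top, Ideal.eq_top_iff_one]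
  refine ⟨∑ i : c.support, Finsupp.single ((e i : ℕ)) (c i), ?_⟩
  rw [map_sum, ← hc]
  refine Eq.trans ?_ (Finset.sum_coe_sort c.support fun f => f (c f))
  refine Finset.sum_congr rfl fun i _ => ?_
  simp [g]

/-- A countable direct sum of copies of a finitely generated projective nonzero module over a
domain is free. -/
theorem nonempty_finsupp_equiv_of_projective [IsDomain A] (P : Type*) [AddCommGroup P]
    [Module A P] [Module.Finite A P] [Module.Projective A P] [Nontrivial P] :
    Nonempty ((ℕ →₀ P) ≃ₗ[A] (ℕ →₀ A)) := by
  let sq : ∀ (M : Type _) [AddCommGroup M] [Module A M], (ℕ →₀ M) ≃ₗ[A] (ℕ →₀ ℕ →₀ M) :=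
    fun M _ _ => (Finsupp.domLCongr Nat.pairEquiv.symm).trans (Finsupp.curryLinearEquiv A)
  let sq' : (ℕ →₀ A) ≃ₗ[A] (ℕ →₀ ℕ →₀ A) :=
    (Finsupp.domLCongr Nat.pairEquiv.symm).trans (Finsupp.curryLinearEquiv A)
  let db : ∀ (M : Type _) [AddCommGroup M] [Module A M],
      (ℕ →₀ M) ≃ₗ[A] (ℕ →₀ M) × (ℕ →₀ M) :=
    fun M _ _ => (Finsupp.domLCongr Equiv.natSumNatEquivNat.symm).trans
      (Finsupp.sumFinsuppLEquivProdFinsupp A)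
  let db' : (ℕ →₀ A) ≃ₗ[A] (ℕ →₀ A) × (ℕ →₀ A) :=
    (Finsupp.domLCongr Equiv.natSumNatEquivNat.symm).trans (Finsupp.sumFinsuppLEquivProdFinsupp A)
  obtain ⟨f, hf⟩ := exists_surjective_of_projective (A := A) P
  obtain ⟨e1⟩ := f.nonempty_equiv_ker_prod hf
  obtain ⟨s, hs⟩ : ∃ s : (ℕ →₀ A) →ₗ[A] P, Function.Surjective s := by
    obtain ⟨n, s, hs⟩ := Module.Finite.exists_fin (R := A) (M := P)
    refine ⟨Finsupp.linearCombination A fun i => if h : i < n then s ⟨i, h⟩ else 0, ?_⟩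
    rw [← LinearMap.range_eq_top, Finsupp.range_linearCombination, eq_top_iff, ← hs]
    refine Submodule.span_mono ?_
    rintro _ ⟨i, rfl⟩
    exact ⟨i, by simp⟩
  obtain ⟨e2⟩ := s.nonempty_equiv_ker_prod hs
  let K := LinearMap.ker f
  let Q := LinearMap.ker s
  -- `P^(ℕ) ≃ K^(ℕ) × A^(ℕ)` and `A^(ℕ) ≃ Q^(ℕ) × P^(ℕ)`
  let u : (ℕ →₀ P) ≃ₗ[A] (ℕ →₀ K) × (ℕ →₀ A) :=
    (sq P).trans ((Finsupp.mapRange.linearEquiv e1).trans (finsuppProdValuesEquiv ℕ A K A))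
  let w : (ℕ →₀ A) ≃ₗ[A] (ℕ →₀ Q) × (ℕ →₀ P) :=
    sq'.trans ((Finsupp.mapRange.linearEquiv e2).trans (finsuppProdValuesEquiv ℕ A Q P))
  -- Split `A^(ℕ)` into two copies and recombine one of them with `K^(ℕ)` into `P^(ℕ)`, so that
  -- `P^(ℕ)` absorbs `A^(ℕ)`. By symmetry `A^(ℕ)` absorbs `P^(ℕ)`, hence they are isomorphic.
  let u' : (ℕ →₀ P) ≃ₗ[A] (ℕ →₀ P) × (ℕ →₀ A) :=
    u.trans (((LinearEquiv.refl A _).prodCongr db').trans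
      ((LinearEquiv.prodAssoc A _ _ _).symm.trans (u.symm.prodCongr (LinearEquiv.refl A _))))
  let w' : (ℕ →₀ A) ≃ₗ[A] (ℕ →₀ A) × (ℕ →₀ P) :=
    w.trans (((LinearEquiv.refl A _).prodCongr (db P)).trans
      ((LinearEquiv.prodAssoc A _ _ _).symm.trans (w.symm.prodCongr (LinearEquiv.refl A _))))
  exact ⟨u'.trans ((LinearEquiv.prodComm A _ _).trans w'.symm)⟩

end Swindle

/-! ### Coefficients and degrees of twisted polynomials -/

namespace TwistedPolynomial

variable {Fq K : Type*} [Field Fq] [Fintype Fq] [Field K] [Algebra Fq K]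

@[ext]
theorem ext {f g : TwistedPolynomial Fq K} (h : ∀ n, f.coeff n = g.coeff n) : f = g :=
  SkewPolynomial.ext h

theorem mem_support_iff {f : TwistedPolynomial Fq K} {n : ℕ} : n ∈ f.support ↔ f.coeff n ≠ 0 :=
  SkewPolynomial.mem_support_iff

/-- Taking a coefficient is additive. -/
def coeffHom (n : ℕ) : TwistedPolynomial Fq K →+ K where
  toFun f := f.coeff n
  map_zero' := SkewPolynomial.coeff_zero n
  map_add' f g := SkewPolynomial.coeff_add f g n

/-- The twisted polynomial `c τ ^ n`. -/
def monomial (n : ℕ) : K →+ TwistedPolynomial Fq K :=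
  (SkewPolynomial.monomial n : K →ₗ[K] SkewPolynomial K).toAddMonoidHom

theorem coeff_monomial (n m : ℕ) (c : K) :
    (monomial n c : TwistedPolynomial Fq K).coeff m = if n = m then c else 0 :=
  SkewPolynomial.coeff_monomial

theorem coeff_C (c : K) (n : ℕ) :
    (C c : TwistedPolynomial Fq K).coeff n = if 0 = n then c else 0 :=
  coeff_monomial (Fq := Fq) 0 n c

@[simp]
theorem coeff_zero (n : ℕ) : (0 : TwistedPolynomial Fq K).coeff n = 0 :=
  map_zero (coeffHom (Fq := Fq) (K := K) n)

theorem coeff_add (f g : TwistedPolynomial Fq K) (n : ℕ) :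
    (f + g).coeff n = f.coeff n + g.coeff n :=
  map_add (coeffHom n) f g

theorem coeff_sub (f g : TwistedPolynomial Fq K) (n : ℕ) :
    (f - g).coeff n = f.coeff n - g.coeff n :=
  map_sub (coeffHom n) f g

theorem coeff_neg (f : TwistedPolynomial Fq K) (n : ℕ) : (-f).coeff n = -f.coeff n :=
  map_neg (coeffHom n) f

theorem monomial_mul_monomial (n m : ℕ) (a b : K) :
    (monomial n a * monomial m b : TwistedPolynomial Fq K) =
      monomial (n + m) (a * b ^ Fintype.card Fq ^ n) := by
  let _ := frobeniusAction Fq K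
  have h := SkewPolynomial.monomial_mul_monomial n m a b
  rw [SkewPolynomial.φ_iterate_apply] at h
  have h2 := frobeniusAction_smul Fq K n b
  rw [← h2]
  exact h

theorem addHom_ext {M : Type*} [AddCommGroup M] {f g : TwistedPolynomial Fq K →+ M}
    (h : ∀ n c, f (monomial n c) = g (monomial n c)) : f = g :=
  SkewPolynomial.addHom_ext (f := (f : SkewPolynomial K →+ M)) (g := (g : SkewPolynomial K →+ M)) h

/-- Both sides are biadditive in `f` and `g`, so monomials suffice. -/
theorem coeff_mul (f g : TwistedPolynomial Fq K) (k : ℕ) :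
    (f * g).coeff k =
      ∑ x ∈ Finset.HasAntidiagonal.antidiagonal k, f.coeff x.1 * g.coeff x.2 ^ Fintype.card Fq ^ x.1 := by
  let F1 : TwistedPolynomial Fq K →+ TwistedPolynomial Fq K →+ K :=
    (AddMonoidHom.compHom (coeffHom k)).comp AddMonoidHom.mul
  let F2 : TwistedPolynomial Fq K →+ TwistedPolynomial Fq K →+ K :=
    ∑ x ∈ Finset.HasAntidiagonal.antidiagonal k, (AddMonoidHom.compl₂
      (AddMonoidHom.comp AddMonoidHom.mul (coeffHom x.1))
      ((tau Fq K ^ x.1 : AddMonoid.End K).comp (coeffHom x.2)))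
  have hF2 : ∀ f g, F2 f g =
      ∑ x ∈ Finset.HasAntidiagonal.antidiagonal k, f.coeff x.1 * g.coeff x.2 ^ Fintype.card Fq ^ x.1 := by
    intro f g
    simp only [F2, AddMonoidHom.finsetSum_apply]
    refine Finset.sum_congr rfl fun x _ => ?_
    rw [← tau_pow_apply (Fq := Fq)]
    rfl
  have h : F1 = F2 := by
    refine addHom_ext fun n a => addHom_ext fun m b => ?_
    rw [hF2]
    change (monomial n a * monomial m b : TwistedPolynomial Fq K).coeff k = _
    rw [monomial_mul_monomial, coeff_monomial]
    split_ifs with hk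
    · rw [Finset.sum_eq_single (n, m)]
      · simp [coeff_monomial]
      · rintro ⟨i, j⟩ _ hne
        simp only [coeff_monomial]
        split_ifs with h1 h2
        · exact absurd (by rw [h1, h2]) hne
        · simp
        · simp
        · simp
      · intro h
        exact absurd (Finset.HasAntidiagonal.mem_antidiagonal.2 hk) h
    · refine (Finset.sum_eq_zero ?_).symm
      rintro ⟨i, j⟩ hij
      rw [Finset.HasAntidiagonal.mem_antidiagonal] at hij
      simp only [coeff_monomial]
      split_ifs with h1 h2
      · exact absurd (by rw [h1, h2]; exact hij) hk
      · simp
      · simp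
      · simp
  rw [← hF2, ← h]
  rfl

/-- The product of the top coefficients is, up to a twist, the top coefficient of the product. -/
theorem coeff_mul_of_top {f g : TwistedPolynomial Fq K} {n m : ℕ}
    (hf : ∀ i, n < i → f.coeff i = 0) (hg : ∀ j, m < j → g.coeff j = 0) :
    (f * g).coeff (n + m) = f.coeff n * g.coeff m ^ Fintype.card Fq ^ n ∧
      ∀ k, n + m < k → (f * g).coeff k = 0 := by
  have hq : ∀ i : ℕ, Fintype.card Fq ^ i ≠ 0 := fun i => pow_ne_zero _ Fintype.card_ne_zero
  constructor
  · rw [coeff_mul, Finset.sum_eq_single (n, m)]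
    · rintro ⟨i, j⟩ hij hne
      rw [Finset.HasAntidiagonal.mem_antidiagonal] at hij
      simp only at hij ⊢
      rcases lt_or_ge n i with h | h
      · rw [hf i h, zero_mul]
      · rw [hg j, zero_pow (hq i), mul_zero]
        by_contra hj
        exact hne (by
          rw [Prod.mk.injEq]
          lia)
    · intro h
      exact (h (Finset.HasAntidiagonal.mem_antidiagonal.2 rfl)).elim
  · intro k hk
    rw [coeff_mul]
    refine Finset.sum_eq_zero ?_
    rintro ⟨i, j⟩ hij
    rw [Finset.HasAntidiagonal.mem_antidiagonal] at hij
    simp only at hij ⊢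
    rcases lt_or_ge n i with h | h
    · rw [hf i h, zero_mul]
    · rw [hg j (by lia), zero_pow (hq i), mul_zero]

theorem exists_top {f : TwistedPolynomial Fq K} (hf : f ≠ 0) :
    ∃ n, f.coeff n ≠ 0 ∧ ∀ m, n < m → f.coeff m = 0 := by
  have hne : f.support.Nonempty := by
    by_contra h
    rw [Finset.not_nonempty_iff_eq_empty] at h
    refine hf (ext fun n => ?_)
    by_contra hn
    have := mem_support_iff.2 hn
    rw [h] at this
    exact absurd this (Finset.notMem_empty n)
  refine ⟨f.support.max' hne, mem_support_iff.1 (Finset.max'_mem _ _), fun m hm => ?_⟩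
  by_contra h
  exact absurd (Finset.le_max' _ _ (mem_support_iff.2 h)) (not_le.2 hm)

theorem exists_coeff_eq_zero (f : TwistedPolynomial Fq K) : ∃ n, ∀ m, n ≤ m → f.coeff m = 0 := by
  by_cases hf : f = 0
  · exact ⟨0, fun m _ => by rw [hf, coeff_zero]⟩
  · obtain ⟨n, _, hn⟩ := exists_top hf
    exact ⟨n + 1, fun m hm => hn m hm⟩

instance : NoZeroDivisors (TwistedPolynomial Fq K) where
  eq_zero_or_eq_zero_of_mul_eq_zero {f g} h := by
    by_contra! hne
    obtain ⟨n, hn, hn'⟩ := exists_top hne.1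
    obtain ⟨m, hm, hm'⟩ := exists_top hne.2
    have := (coeff_mul_of_top hn' hm').1
    rw [h, coeff_zero] at this
    exact mul_ne_zero hn (pow_ne_zero _ hm) this.symm

/-- A twisted polynomial that is algebraic over `Fq` is constant. -/
theorem coeff_eq_zero_of_aeval_eq_zero {f : TwistedPolynomial Fq K} {g : Polynomial Fq}
    (hg : g ≠ 0) (h : Polynomial.aeval f g = 0) {n : ℕ} (hn : 0 < n) : f.coeff n = 0 := by
  by_contra hfn
  have hf : f ≠ 0 := by
    rintro rfl
    exact hfn (coeff_zero n)
  obtain ⟨m, hm, hm'⟩ := exists_top hf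
  have hm0 : 0 < m := by
    by_contra h0
    exact hfn (hm' n (by lia))
  -- With `g = X g₁ + g(0)` the relation reads `f * g₁(f) = -g(0)`. If `g₁(f) ≠ 0`, the left side
  -- has degree at least `m > 0`, which is impossible; otherwise `g₁` is a smaller relation, or
  -- zero, which forces `g = 0`.
  induction hd : g.natDegree using Nat.strong_induction_on generalizing g with
  | _ d ih =>
    have h1 : f * Polynomial.aeval f g.divX = -C (algebraMap Fq K (g.coeff 0)) := by
      have h2 := h
      rw [← Polynomial.X_mul_divX_add g, map_add, map_mul, Polynomial.aeval_X,
        Polynomial.aeval_C] at h2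
      exact eq_neg_of_add_eq_zero_left h2
    by_cases hu : Polynomial.aeval f g.divX = 0
    · by_cases hX : g.divX = 0
      · rw [hu, mul_zero, eq_comm, neg_eq_zero] at h1
        have h3 := congrArg (fun f => coeff f 0) h1
        simp only [coeff_C, if_true, coeff_zero] at h3
        have h4 := Polynomial.X_mul_divX_add g
        rw [hX, mul_zero, zero_add] at h4
        rw [(algebraMap Fq K).injective (h3.trans (map_zero _).symm), Polynomial.C_0] at h4
        exact hg h4.symm
      · have hlt : g.divX.natDegree < d := by
          rw [Polynomial.natDegree_divX_eq_natDegree_tsub_one, ← hd]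
          have : g.natDegree ≠ 0 := by
            intro h0
            exact hX (Polynomial.divX_eq_zero_iff.2 (Polynomial.eq_C_of_natDegree_eq_zero h0))
          lia
        exact ih _ hlt hX hu rfl
    · obtain ⟨l, hl, hl'⟩ := exists_top hu
      have h2 := (coeff_mul_of_top hm' hl').1
      rw [h1, coeff_neg, coeff_C, if_neg (by lia), neg_zero] at h2
      exact mul_ne_zero hm (pow_ne_zero _ hl) h2.symm

/-- Evaluation as a sum over a range that contains the support. -/
theorem eval_eq_sum_range (L : Type*) [Field L] [Algebra K L] (f : TwistedPolynomial Fq K) (x : L)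
    {N : ℕ} (hN : ∀ m, N ≤ m → f.coeff m = 0) :
    eval L f x = ∑ n ∈ Finset.range N, algebraMap K L (f.coeff n) * x ^ Fintype.card Fq ^ n := by
  rw [eval_apply]
  refine Finset.sum_subset (fun n hn => ?_) fun n _ hn => ?_
  · rw [Finset.mem_range]
    by_contra h
    exact mem_support_iff.1 hn (hN n (not_lt.1 h))
  · rw [mem_support_iff, not_not] at hn
    rw [hn, map_zero, zero_mul]

theorem eval_monomial (L : Type*) [Field L] [Algebra K L] (n : ℕ) (c : K) (x : L) :
    eval L (monomial n c : TwistedPolynomial Fq K) x =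
      algebraMap K L c * x ^ Fintype.card Fq ^ n := by
  rw [eval_eq_sum_range (N := n + 1) L _ x fun m hm => by rw [coeff_monomial, if_neg (by lia)],
    Finset.sum_eq_single n]
  · rw [coeff_monomial, if_pos rfl]
  · intro m _ hm
    rw [coeff_monomial, if_neg hm.symm, map_zero, zero_mul]
  · intro h
    exact absurd (Finset.mem_range.2 n.lt_succ_self) h

end TwistedPolynomial

/-! ### The ring of functions and finite fields of constants -/

/-- A subalgebra of a field that contains every element of the field integral over it is
integrally closed. -/
theorem Subalgebra.isIntegrallyClosed_of_forall {F k : Type*} [Field F] [Field k] [Algebra F k]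
    (A : Subalgebra F k) (h : ∀ x : k, IsIntegral A x → x ∈ A) : IsIntegrallyClosed A := by
  rw [isIntegrallyClosed_iff (FractionRing A)]
  intro x hx
  let f : FractionRing A →ₐ[A] k := IsFractionRing.liftAlgHom (g := Algebra.ofId A k)
    (FaithfulSMul.algebraMap_injective A k)
  have h1 : f x ∈ A := h _ (hx.map f)
  exact ⟨⟨f x, h1⟩, f.toRingHom.injective (f.commutes _)⟩

/-- The ring is an intersection of discrete valuation rings, and each of these is integrally closed.
-/
instance affineRing_isIntegrallyClosed {F k : Type*} [Field F] [Field k] [Algebra F k]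
    (infty : CurvePoint F k) : IsIntegrallyClosed (affineRing infty) := by
  refine Subalgebra.isIntegrallyClosed_of_forall _ fun x hx P hP => ?_
  let g : affineRing infty →+* P.localRing :=
    (algebraMap (affineRing infty) k).codRestrict P.localRing fun a => a.2 P hP
  have h1 : IsIntegral P.localRing x := hx.map_of_comp_eq g (RingHom.id k) (RingHom.ext fun _ => rfl)
  obtain ⟨y, hy⟩ := (IsIntegrallyClosed.isIntegral_iff (R := P.localRing) (K := k)).1 h1
  rw [← hy]
  exact y.2

/-- In a subalgebra of a field of transcendence degree one, any element is algebraic over the base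
field modulo any nonzero ideal. -/
theorem exists_aeval_eq_mul_of_trdeg_eq_one {F k : Type*} [Field F] [Field k] [Algebra F k]
    (hk : Algebra.trdeg F k = 1) (A : Subalgebra F k) {a : A} (ha : a ≠ 0) (b : A) :
    ∃ g : Polynomial F, g ≠ 0 ∧ ∃ z : A, Polynomial.aeval b g = a * z := by
  by_cases hb : IsAlgebraic F b
  · obtain ⟨g, hg, hgb⟩ := hb
    exact ⟨g, hg, 0, by rw [hgb, mul_zero]⟩
  have hb' : Transcendental F (b : k) :=
    (transcendental_algebraMap_iff (S := A) (A := k) Subtype.val_injective).2 hb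
  have hx : AlgebraicIndependent F (fun _ : Unit => (b : k)) :=
    (algebraicIndependent_unique_type_iff).2 hb'
  have hbas : IsTranscendenceBasis F (fun _ : Unit => (b : k)) :=
    hx.isTranscendenceBasis_of_lift_trdeg_le_of_finite (by simp [hk])
  have halg := hbas.isAlgebraic.isAlgebraic (a : k)
  rw [Set.range_const] at halg
  -- Since `a ≠ 0` is algebraic over `F[b]`, it satisfies an equation with nonzero constant term
  -- `g(b)`. Moving the other terms across exhibits `g(b)` as a multiple of `a`.
  obtain ⟨p, hp0, hp⟩ := halg.exists_nonzero_coeff_and_aeval_eq_zero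
    (mem_nonZeroDivisors_of_ne_zero (by simpa using ha))
  have hle : Algebra.adjoin F {(b : k)} ≤ A := Algebra.adjoin_le (by simp)
  obtain ⟨g, hg⟩ := (Algebra.adjoin_singleton_eq_range_aeval F (b : k)).le (p.coeff 0).2
  have hz : -Polynomial.aeval (a : k) p.divX ∈ A := by
    refine neg_mem ?_
    rw [Polynomial.aeval_eq_sum_range]
    refine sum_mem fun i _ => ?_
    rw [Algebra.smul_def]
    exact mul_mem (hle (p.divX.coeff i).2) (pow_mem a.2 i)
  refine ⟨g, ?_, ⟨_, hz⟩, ?_⟩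
  · rintro rfl
    refine hp0 (Subtype.ext ?_)
    rw [← hg]
    simp
  · refine Subtype.ext ?_
    have h1 : ((Polynomial.aeval b g : A) : k) = Polynomial.aeval (b : k) g :=
      (Polynomial.aeval_algHom_apply A.val b g).symm
    have h2 := hp
    rw [← Polynomial.X_mul_divX_add p, map_add, map_mul, Polynomial.aeval_X,
      Polynomial.aeval_C] at h2
    rw [h1]
    change _ = (a : k) * -Polynomial.aeval (a : k) p.divX
    rw [mul_neg, ← eq_neg_of_add_eq_zero_right h2]
    exact hg

/-- An integrally closed domain that is finite over a Dedekind domain is a Dedekind domain. -/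
theorem isDedekindDomain_of_finite (R A : Type*) [CommRing R] [IsDedekindDomain R] [CommRing A]
    [IsDomain A] [IsIntegrallyClosed A] [Algebra R A] [Module.Finite R A] :
    IsDedekindDomain A := by
  have h1 : IsNoetherianRing A := IsNoetherianRing.of_finite R A
  have h2 : Ring.DimensionLEOne A := ⟨fun {p} hp hprime => by
    have h3 : p.comap (algebraMap R A) ≠ ⊥ := Ideal.IsIntegral.comap_ne_bot R hp
    have h4 : (p.comap (algebraMap R A)).IsPrime := Ideal.comap_isPrime _ _
    exact Ideal.isMaximal_of_isIntegral_of_isMaximal_comap p (h4.isMaximal h3)⟩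
  have h5 : IsDedekindRing A := (isDedekindRing_iff A (FractionRing A)).2
    ⟨h1, h2, fun {_} => (isIntegrallyClosed_iff (FractionRing A)).1 inferInstance⟩
  infer_instance

/-- Every element of a finite subfield is a `q ^ r`-th power in this subfield. -/
theorem Subfield.exists_pow_card_pow_eq (Fq : Type*) {K : Type*} [Field Fq] [Fintype Fq] [Field K]
    [Algebra Fq K] (E : Subfield K) [Finite E] (r : ℕ) {c : K} (hc : c ∈ E) :
    ∃ e ∈ E, e ^ Fintype.card Fq ^ r = c := by
  let f : E → E := fun e => e ^ Fintype.card Fq ^ r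
  have hf : Function.Injective f := by
    intro x y hxy
    have h1 : (x : K) ^ Fintype.card Fq ^ r = (y : K) ^ Fintype.card Fq ^ r :=
      congrArg Subtype.val hxy
    rw [← TwistedPolynomial.tau_pow_apply (Fq := Fq), ← TwistedPolynomial.tau_pow_apply (Fq := Fq),
      ← sub_eq_zero, ← map_sub, TwistedPolynomial.tau_pow_apply] at h1
    exact Subtype.ext (sub_eq_zero.1 (eq_zero_of_pow_eq_zero h1))
  obtain ⟨e, he⟩ := Finite.injective_iff_surjective.1 hf ⟨c, hc⟩
  exact ⟨e, e.2, congrArg Subtype.val he⟩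

/-! ### Twisted polynomials over a finite field of definition, as an `A`-module -/

namespace DrinfeldModule

variable {Fq A K : Type*} [Field Fq] [Fintype Fq] [CommRing A] [Algebra Fq A]
  [Field K] [Algebra Fq K] {i : A →ₐ[Fq] K} (φ : DrinfeldModule i)

theorem exists_coeff_ne_zero : ∃ t n, 0 < n ∧ (φ.toAlgHom t).coeff n ≠ 0 := by
  obtain ⟨t, ht⟩ := φ.exists_ne
  by_contra! h
  refine ht (TwistedPolynomial.ext fun n => ?_)
  rw [TwistedPolynomial.coeff_C]
  split_ifs with hn
  · rw [← hn, φ.coeff_zero]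
  · exact h t n (Nat.pos_of_ne_zero fun h0 => hn h0.symm)

/-- If every element of `A` is algebraic over `Fq` modulo every nonzero ideal, then `φ` is
injective. -/
theorem injective_toAlgHom
    (hA : ∀ a : A, a ≠ 0 → ∀ b : A, ∃ g : Polynomial Fq, g ≠ 0 ∧ ∃ z, Polynomial.aeval b g = a * z) :
    Function.Injective φ.toAlgHom := by
  rw [injective_iff_map_eq_zero]
  intro a ha
  by_contra ha0
  obtain ⟨t, n, hn, ht⟩ := φ.exists_coeff_ne_zero
  -- If `φ_a = 0`, then `g(φ_t) = φ_a φ_z = 0`, so `φ_t` is algebraic over `Fq` and hence constant,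
  -- against the choice of `t`.
  obtain ⟨g, hg, z, hz⟩ := hA a ha0 t
  refine ht (TwistedPolynomial.coeff_eq_zero_of_aeval_eq_zero hg ?_ hn)
  rw [Polynomial.aeval_algHom_apply, hz, map_mul, ha, zero_mul]

/-- The ring `K{τ}` as an `A`-module, where `a` acts by left multiplication with `φ_a`. -/
def Twisted (_φ : DrinfeldModule i) : Type _ := TwistedPolynomial Fq K

instance : AddCommGroup φ.Twisted := inferInstanceAs (AddCommGroup (TwistedPolynomial Fq K))

/-- The underlying twisted polynomial. -/
def Twisted.toPoly {φ : DrinfeldModule i} : φ.Twisted ≃+ TwistedPolynomial Fq K := AddEquiv.refl _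

instance : Module A φ.Twisted :=
  letI : Module (TwistedPolynomial Fq K) φ.Twisted :=
    inferInstanceAs (Module (TwistedPolynomial Fq K) (TwistedPolynomial Fq K))
  Module.compHom φ.Twisted (φ.toAlgHom : A →+* TwistedPolynomial Fq K)

theorem Twisted.toPoly_smul (a : A) (f : φ.Twisted) :
    (a • f).toPoly = φ.toAlgHom a * f.toPoly := rfl

variable {φ} {E : Subfield K}

/-- The twisted polynomials with coefficients in a field of definition of `φ`. -/
def IsDefinedOver.twisted (hE : φ.IsDefinedOver E) : Submodule A φ.Twisted where
  carrier := {f | ∀ n, f.toPoly.coeff n ∈ E}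
  zero_mem' n := by
    rw [map_zero, TwistedPolynomial.coeff_zero]
    exact E.zero_mem
  add_mem' {f g} hf hg n := by
    rw [map_add, TwistedPolynomial.coeff_add]
    exact E.add_mem (hf n) (hg n)
  smul_mem' a f hf n := by
    rw [Twisted.toPoly_smul, TwistedPolynomial.coeff_mul]
    exact sum_mem fun x _ => mul_mem (hE a x.1) (pow_mem (hf x.2) _)

/-- A monomial with coefficient in a field of definition. -/
def IsDefinedOver.monomial (hE : φ.IsDefinedOver E) (n : ℕ) (e : E) : hE.twisted :=
  ⟨Twisted.toPoly.symm (TwistedPolynomial.monomial n (e : K)), fun m => by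
    rw [AddEquiv.apply_symm_apply, TwistedPolynomial.coeff_monomial]
    split_ifs
    exacts [e.2, E.zero_mem]⟩

theorem IsDefinedOver.toPoly_monomial (hE : φ.IsDefinedOver E) (n : ℕ) (e : E) :
    (hE.monomial n e : φ.Twisted).toPoly = TwistedPolynomial.monomial n (e : K) := rfl

/-- The twisted polynomials over `E` are generated by any submonoid that contains the monomials of
small degree and is stable under multiplication by some `φ_t` that is not constant. -/
theorem IsDefinedOver.eq_top_of_monomial_mem [Finite E] (hE : φ.IsDefinedOver E) {t : A} {r : ℕ}
    (hr : 0 < r) (ht : (φ.toAlgHom t).coeff r ≠ 0)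
    (ht' : ∀ n, r < n → (φ.toAlgHom t).coeff n = 0) (M : AddSubgroup hE.twisted)
    (hM : ∀ n, n < r → ∀ e, hE.monomial n e ∈ M) (hMt : ∀ f ∈ M, t • f ∈ M) : M = ⊤ := by
  have key : ∀ n, ∀ f : hE.twisted, (∀ m, n ≤ m → (f : φ.Twisted).toPoly.coeff m = 0) → f ∈ M := by
    intro n
    induction n with
    | zero =>
      intro f hf
      have : f = 0 := Subtype.ext (TwistedPolynomial.ext fun m => by
        exact (hf m (Nat.zero_le m)).trans (TwistedPolynomial.coeff_zero m).symm)
      rw [this]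
      exact M.zero_mem
    | succ n ih =>
      intro f hf
      rcases lt_or_ge n r with hn | hn
      · let c : E := ⟨(f : φ.Twisted).toPoly.coeff n, f.2 n⟩
        have h1 : f - hE.monomial n c ∈ M := by
          refine ih _ fun m hm => ?_
          change ((f : φ.Twisted).toPoly - TwistedPolynomial.monomial n (c : K)).coeff m = 0
          rw [TwistedPolynomial.coeff_sub, TwistedPolynomial.coeff_monomial]
          split_ifs with h
          · rw [← h, sub_self]
          · rw [hf m (by lia), sub_zero]
        simpa using M.add_mem h1 (hM n hn c)
      -- Division with remainder: `e` solves `c_r e ^ (q ^ r) = c_n` for the top coefficient `c_r`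
      -- of `φ_t`, so subtracting `φ_t e τ ^ (n - r)` removes the term of degree `n`. As `r > 0`,
      -- the induction hypothesis covers `e τ ^ (n - r)`.
      · obtain ⟨e, he, hec⟩ := E.exists_pow_card_pow_eq Fq r
          (E.div_mem (f.2 n) (hE t r))
        have htop := TwistedPolynomial.coeff_mul_of_top (f := φ.toAlgHom t)
          (g := TwistedPolynomial.monomial (n - r) e) (n := r) (m := n - r) ht' fun j hj => by
            rw [TwistedPolynomial.coeff_monomial, if_neg (by lia)]
        have h1 : f - t • hE.monomial (n - r) ⟨e, he⟩ ∈ M := by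
          refine ih _ fun m hm => ?_
          change ((f : φ.Twisted).toPoly -
            φ.toAlgHom t * TwistedPolynomial.monomial (n - r) e).coeff m = 0
          rw [TwistedPolynomial.coeff_sub]
          rcases hm.eq_or_lt with h | h
          · have h2 := htop.1
            rw [TwistedPolynomial.coeff_monomial, if_pos rfl, hec, mul_div_cancel₀ _ ht,
              Nat.add_sub_cancel' hn] at h2
            rw [← h, h2, sub_self]
          · rw [hf m h, htop.2 m (by lia), sub_zero]
        have h2 : hE.monomial (n - r) ⟨e, he⟩ ∈ M := by
          refine ih _ fun m hm => ?_
          rw [hE.toPoly_monomial, TwistedPolynomial.coeff_monomial, if_neg (by lia)]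
        simpa using M.add_mem h1 (hMt _ h2)
  refine eq_top_iff.2 fun f _ => ?_
  obtain ⟨n, hn⟩ := TwistedPolynomial.exists_coeff_eq_zero (f : φ.Twisted).toPoly
  exact key n f hn

theorem exists_top_coeff : ∃ t r, 0 < r ∧ (φ.toAlgHom t).coeff r ≠ 0 ∧
    ∀ n, r < n → (φ.toAlgHom t).coeff n = 0 := by
  obtain ⟨t, n, hn, ht⟩ := φ.exists_coeff_ne_zero
  have h0 : φ.toAlgHom t ≠ 0 := by
    intro h
    rw [h] at ht
    exact ht (TwistedPolynomial.coeff_zero n)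
  obtain ⟨r, hr, hr'⟩ := TwistedPolynomial.exists_top h0
  refine ⟨t, r, ?_, hr, hr'⟩
  by_contra h
  exact ht (hr' n (by lia))

/-- The twisted polynomials over a finite field of definition are a finitely generated module over
`A`, and `A` itself is finite over a polynomial ring. -/
theorem IsDefinedOver.finite_twisted [Finite E] (hE : φ.IsDefinedOver E)
    (hinj : Function.Injective φ.toAlgHom) :
    Module.Finite A hE.twisted ∧
      ∃ _ : Algebra (Polynomial Fq) A, Module.Finite (Polynomial Fq) A := by
  obtain ⟨t, r, hr, ht, ht'⟩ := φ.exists_top_coeff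
  let _ : Algebra (Polynomial Fq) A := (Polynomial.aeval t : Polynomial Fq →ₐ[Fq] A).toAlgebra
  let _ : Module (Polynomial Fq) hE.twisted :=
    Module.compHom hE.twisted (algebraMap (Polynomial Fq) A)
  have _ : IsScalarTower (Polynomial Fq) A hE.twisted :=
    ⟨fun f a x => by
      rw [Algebra.smul_def, mul_smul]
      rfl⟩
  have hX : ∀ f : hE.twisted, (Polynomial.X : Polynomial Fq) • f = t • f := fun f => by
    change (Polynomial.aeval t (Polynomial.X : Polynomial Fq)) • f = _
    rw [Polynomial.aeval_X]
  let s : Set hE.twisted := Set.range fun x : Fin r × E => hE.monomial x.1 x.2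
  have hs : Submodule.span (Polynomial Fq) s = ⊤ := by
    have := hE.eq_top_of_monomial_mem hr ht ht' (Submodule.span (Polynomial Fq) s).toAddSubgroup
      (fun n hn e => Submodule.subset_span ⟨(⟨n, hn⟩, e), rfl⟩) fun f hf => by
        have h1 := Submodule.smul_mem _ (Polynomial.X : Polynomial Fq) hf
        rw [hX] at h1
        exact h1
    rw [eq_top_iff]
    intro f _
    have h2 : f ∈ (⊤ : AddSubgroup hE.twisted) := trivial
    rw [← this] at h2
    exact h2
  have hfin : Module.Finite (Polynomial Fq) hE.twisted :=
    ⟨Submodule.fg_def.2 ⟨s, Set.finite_range _, hs⟩⟩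
  refine ⟨Module.Finite.of_restrictScalars_finite (Polynomial Fq) A hE.twisted, inferInstance, ?_⟩
  have hmem : ∀ a : A, (Twisted.toPoly.symm (φ.toAlgHom a) : φ.Twisted) ∈ hE.twisted :=
    fun a n => hE a n
  -- Through `a ↦ φ_a`, the ring `A` is a submodule of a finitely generated module over the
  -- noetherian ring `Fq[X]`, with `X` acting as `t`.
  let f : A →ₗ[Polynomial Fq] hE.twisted :=
    { toFun := fun a => ⟨_, hmem a⟩
      map_add' := fun a b => Subtype.ext (by
        change φ.toAlgHom (a + b) = φ.toAlgHom a + φ.toAlgHom b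
        rw [map_add])
      map_smul' := fun g a => Subtype.ext (by
        rw [Algebra.smul_def]
        change φ.toAlgHom (algebraMap (Polynomial Fq) A g * a) =
          φ.toAlgHom (algebraMap (Polynomial Fq) A g) * φ.toAlgHom a
        rw [map_mul]) }
  exact Module.Finite.of_injective f fun a b hab => hinj (congrArg Subtype.val hab)

theorem IsDefinedOver.isTorsionFree_twisted [IsDomain A] (hE : φ.IsDefinedOver E)
    (hinj : Function.Injective φ.toAlgHom) : Module.IsTorsionFree A hE.twisted := by
  refine Module.IsTorsionFree.of_smul_eq_zero fun a f h => ?_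
  have h1 : φ.toAlgHom a * (f : φ.Twisted).toPoly = 0 := congrArg Subtype.val h
  rcases mul_eq_zero.1 h1 with h | h
  · exact Or.inl (hinj (h.trans (map_zero _).symm))
  · exact Or.inr (Subtype.ext h)

/-- A countable direct sum of copies of the module of twisted polynomials over a finite field of
definition is free. -/
theorem IsDefinedOver.nonempty_finsupp_equiv [IsDomain A] [IsIntegrallyClosed A] [Finite E]
    (hE : φ.IsDefinedOver E) (hinj : Function.Injective φ.toAlgHom) :
    Nonempty ((ℕ →₀ hE.twisted) ≃ₗ[A] (ℕ →₀ A)) := by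
  obtain ⟨_, _, _⟩ := hE.finite_twisted hinj
  have := isDedekindDomain_of_finite (Polynomial Fq) A
  have := hE.isTorsionFree_twisted hinj
  have := Module.finitePresentation_of_finite A hE.twisted
  -- Torsion-free modules over a Dedekind domain are flat, and flat finitely presented modules are
  -- projective.
  have : Module.Projective A hE.twisted := Module.Flat.projective_of_finitePresentation
  have : Nontrivial hE.twisted := by
    refine ⟨hE.monomial 0 1, 0, fun h => ?_⟩
    have h1 : (TwistedPolynomial.monomial 0 ((1 : E) : K) : TwistedPolynomial Fq K) = 0 :=
      congrArg Subtype.val h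
    have h2 := congrArg (fun f => TwistedPolynomial.coeff f 0) h1
    simp [TwistedPolynomial.coeff_monomial] at h2
  exact nonempty_finsupp_equiv_of_projective hE.twisted

end DrinfeldModule

/-! ### Evaluation of twisted polynomials and the free complement -/

namespace DrinfeldModule

variable {Fq A K : Type*} [Field Fq] [Fintype Fq] [CommRing A] [Algebra Fq A]
  [Field K] [Algebra Fq K] {i : A →ₐ[Fq] K} {φ : DrinfeldModule i} {E : Subfield K}

/-- Evaluation of twisted polynomials at a point. -/
def IsDefinedOver.evalAt (hE : φ.IsDefinedOver E) (L : Type*) [Field L] [Algebra K L] (x : L) :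
    hE.twisted →ₗ[A] φ.Points L where
  toFun f := Points.toField.symm (TwistedPolynomial.eval L (f : φ.Twisted).toPoly x)
  map_add' f g := congrArg (fun h : AddMonoid.End L => Points.toField.symm (h x))
    (map_add (TwistedPolynomial.eval L) (f : φ.Twisted).toPoly (g : φ.Twisted).toPoly)
  map_smul' a f := congrArg (fun h : AddMonoid.End L => Points.toField.symm (h x))
    (map_mul (TwistedPolynomial.eval L) (φ.toAlgHom a) (f : φ.Twisted).toPoly)

theorem IsDefinedOver.evalAt_apply (hE : φ.IsDefinedOver E) (L : Type*) [Field L] [Algebra K L]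
    (x : L) (f : hE.twisted) :
    (hE.evalAt L x f).toField = TwistedPolynomial.eval L (f : φ.Twisted).toPoly x := rfl

/-- The `q`-power endomorphism of an extension of `K`. -/
def powerHom (Fq K L : Type*) [Field Fq] [Fintype Fq] [Field K] [Algebra Fq K] [Field L]
    [Algebra K L] : L →+* L :=
  letI : Algebra Fq L := ((algebraMap K L).comp (algebraMap Fq K)).toAlgebra
  (FiniteField.frobeniusAlgHom Fq L : L →+* L)

theorem powerHom_apply (L : Type*) [Field L] [Algebra K L] (x : L) :
    powerHom Fq K L x = x ^ Fintype.card Fq := rfl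

theorem powerHom_iterate (L : Type*) [Field L] [Algebra K L] (n : ℕ) (x : L) :
    (powerHom Fq K L)^[n] x = x ^ Fintype.card Fq ^ n := by
  induction n with
  | zero => simp
  | succ n ih => rw [Function.iterate_succ_apply', ih, powerHom_apply, ← pow_mul, pow_succ]

/-- The sum of the evaluations of twisted polynomials at the elements of a set. -/
def IsDefinedOver.sumEvalAt (hE : φ.IsDefinedOver E) {L : Type*} [Field L] [Algebra K L]
    (B : Set L) : (B →₀ hE.twisted) →ₗ[A] φ.Points L :=
  Finsupp.lsum A fun b => hE.evalAt L (b : L)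

theorem IsDefinedOver.sumEvalAt_single (hE : φ.IsDefinedOver E) {L : Type*} [Field L]
    [Algebra K L] (B : Set L) (b : B) (f : hE.twisted) :
    hE.sumEvalAt B (Finsupp.single b f) = hE.evalAt L (b : L) f := by
  simp [sumEvalAt]

theorem IsDefinedOver.smul_mem_range_sumEvalAt (hE : φ.IsDefinedOver E) {L : Type*} [Field L]
    [Algebra K L] (B : Set L) (e : E) {b : L} (hb : b ∈ B) :
    Points.toField.symm (e • b) ∈ LinearMap.range (hE.sumEvalAt B) := by
  refine ⟨Finsupp.single ⟨b, hb⟩ (hE.monomial 0 e), ?_⟩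
  rw [hE.sumEvalAt_single]
  refine congrArg Points.toField.symm ?_
  rw [hE.toPoly_monomial, TwistedPolynomial.eval_monomial, pow_zero, pow_one, Algebra.smul_def]
  rfl

/-- Left multiplication by `τ` preserves `E{τ}`, and `τ (f(b)) = (τ f)(b)`. The map `x ↦ x ^ q` need
not be `A`-linear, so the argument uses additivity and single terms only. -/
theorem IsDefinedOver.powerHom_mem_range_sumEvalAt (hE : φ.IsDefinedOver E) {L : Type*} [Field L]
    [Algebra K L] (B : Set L) (f : B →₀ hE.twisted) :
    Points.toField.symm (powerHom Fq K L (hE.sumEvalAt B f).toField) ∈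
      LinearMap.range (hE.sumEvalAt B) := by
  induction f using Finsupp.induction_linear with
  | zero =>
    rw [map_zero, map_zero, map_zero, map_zero]
    exact Submodule.zero_mem _
  | add f g hf hg =>
    rw [map_add, map_add, map_add, map_add]
    exact Submodule.add_mem _ hf hg
  | single b f =>
    let h : TwistedPolynomial Fq K := TwistedPolynomial.monomial 1 1
    have hmem : (Twisted.toPoly.symm (h * (f : φ.Twisted).toPoly) : φ.Twisted) ∈ hE.twisted := by
      intro n
      rw [AddEquiv.apply_symm_apply, TwistedPolynomial.coeff_mul]
      refine sum_mem fun x _ => mul_mem ?_ (pow_mem (f.2 _) _)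
      rw [TwistedPolynomial.coeff_monomial]
      split_ifs
      exacts [E.one_mem, E.zero_mem]
    refine ⟨Finsupp.single b ⟨_, hmem⟩, ?_⟩
    rw [hE.sumEvalAt_single, hE.sumEvalAt_single, hE.evalAt_apply]
    have h1 : TwistedPolynomial.eval L (h * (f : φ.Twisted).toPoly) (b : L) =
        TwistedPolynomial.eval L h (TwistedPolynomial.eval L (f : φ.Twisted).toPoly (b : L)) :=
      congrArg (fun h : AddMonoid.End L => h (b : L)) (map_mul (TwistedPolynomial.eval L) _ _)
    have h2 : ∀ y : L, TwistedPolynomial.eval L h y = powerHom Fq K L y := fun y => by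
      rw [TwistedPolynomial.eval_monomial, map_one, one_mul, pow_one, powerHom_apply]
    rw [h2] at h1
    exact congrArg Points.toField.symm h1

/-- If `B` is independent modulo `q`-th powers, then the sum of the evaluations at the elements of
`B` is injective, even modulo constants. -/
theorem IsDefinedOver.eq_zero_of_sumEvalAt_mem (hE : φ.IsDefinedOver E) {L : Type*} [Field L]
    [Algebra K L] {B : Set L}
    {hσ : ∀ e : E, ∃ e' : E, powerHom Fq K L (algebraMap E L e') = algebraMap E L e}
    (hB : LinearIndepOn E (rangeSubspace (powerHom Fq K L) hσ).mkQ B)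
    (κ : Set L) (hκσ : κ ⊆ Set.range (powerHom Fq K L)) (hκ : ∀ y, powerHom Fq K L y ∈ κ → y ∈ κ)
    (f : B →₀ hE.twisted) (hf : (hE.sumEvalAt B f).toField ∈ κ) : f = 0 := by
  classical
  choose m hm using fun b : B =>
    TwistedPolynomial.exists_coeff_eq_zero (f b : φ.Twisted).toPoly
  let M := f.support.sup m
  let c : L → ℕ → E := fun b n =>
    if h : b ∈ B then ⟨(f ⟨b, h⟩ : φ.Twisted).toPoly.coeff n, (f ⟨b, h⟩).2 n⟩ else 0
  have hc : ∀ (b : B) n, (c b n : K) = (f b : φ.Twisted).toPoly.coeff n := fun b n => by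
    simp [c]
  have hM : ∀ b ∈ f.support, ∀ n, M ≤ n → (f b : φ.Twisted).toPoly.coeff n = 0 :=
    fun b hb n hn => hm b n ((Finset.le_sup hb).trans hn)
  let s : Finset L := f.support.map (Function.Embedding.subtype _)
  have hs : (s : Set L) ⊆ B := by
    intro x hx
    obtain ⟨b, _, rfl⟩ := Finset.mem_map.1 hx
    exact b.2
  have hsum : ∑ b ∈ s, ∑ n ∈ Finset.range M, c b n • ((powerHom Fq K L)^[n] b) = (hE.sumEvalAt B f).toField := by
    rw [Finset.sum_map]
    simp only [sumEvalAt, Finsupp.lsum_apply, Finsupp.sum, map_sum]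
    refine Finset.sum_congr rfl fun b hb => ?_
    rw [hE.evalAt_apply, TwistedPolynomial.eval_eq_sum_range L _ _ (hM b hb)]
    refine Finset.sum_congr rfl fun n _ => ?_
    rw [Algebra.smul_def, ← hc, powerHom_iterate]
    rfl
  have h0 := hB.eq_zero_of_sum_iterate_mem (powerHom Fq K L) κ hκσ hκ hs M c (by
    rw [hsum]
    exact hf)
  ext1 b
  by_contra hb
  have hbs : b ∈ f.support := Finsupp.mem_support_iff.2 hb
  refine hb (Subtype.ext (TwistedPolynomial.ext fun n => ?_))
  have h1 : (f b : φ.Twisted).toPoly.coeff n = 0 := by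
    rcases lt_or_ge n M with hn | hn
    · rw [← hc, h0 b (Finset.mem_map_of_mem _ hbs) n hn]
      rfl
    · exact hM b hbs n hn
  exact h1.trans (TwistedPolynomial.coeff_zero n).symm

/-- If the points of `φ(L)` that are constant, that is, in an algebraically closed subfield `κ`
over which `L` is finitely generated, form a submodule, then this has a free complement. -/
theorem IsDefinedOver.exists_free_complement [IsDomain A] [IsIntegrallyClosed A] [Finite E]
    (hE : φ.IsDefinedOver E) (hinj : Function.Injective φ.toAlgHom)
    {κ L : Type*} [Field κ] [Field L] [Algebra K L] [Algebra κ L] [Algebra.EssFiniteType κ L]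
    [Countable L]
    (hκE : ∀ e : E, algebraMap K L e ∈ (algebraMap κ L).range)
    (hκ : ∀ x : L, IsAlgebraic κ x → x ∈ (algebraMap κ L).range)
    (hκq : ∀ c : κ, ∃ d : κ, d ^ Fintype.card Fq = c)
    (hinf : Infinite κ) (hne : ∃ x : L, x ∉ (algebraMap κ L).range)
    (T : Submodule A (φ.Points L)) (hT : ∀ x, x ∈ T ↔ x.toField ∈ (algebraMap κ L).range) :
    ∃ N : Submodule A (φ.Points L), IsCompl T N ∧ Module.Free A N ∧ Module.rank A N = ℵ₀ := by
  classical
  have hq2 : 2 ≤ Fintype.card Fq := Fintype.one_lt_card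
  obtain ⟨V, hmono, hex, hV0, hV⟩ := exists_root_filtration hκ hq2
  -- The filtration is viewed over `E`, which embeds into `κ`, because the twisted polynomials to be
  -- evaluated have their coefficients in `E`.
  let W : ℕ → Submodule E L := fun n =>
    { (V n).toAddSubmonoid with
      smul_mem' := fun e x hx => by
        obtain ⟨c, hc⟩ := hκE e
        have h1 : e • x = c • x := by
          rw [Algebra.smul_def, Algebra.smul_def, hc]
          rfl
        rw [h1]
        exact (V n).smul_mem c hx }
  let σ := powerHom Fq K L
  have hσ : ∀ e : E, ∃ e' : E, σ (algebraMap E L e') = algebraMap E L e := fun e => by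
    obtain ⟨e', he', h⟩ := E.exists_pow_card_pow_eq Fq 1 e.2
    refine ⟨⟨e', he'⟩, ?_⟩
    rw [pow_one] at h
    change (algebraMap K L e') ^ Fintype.card Fq = algebraMap K L e
    rw [← map_pow, h]
  obtain ⟨B, hB, hBM⟩ := exists_basis_mod_range σ hσ W (fun m n h => hmono h) hex hV
  have hκσ : ((algebraMap κ L).range : Set L) ⊆ Set.range σ := by
    rintro _ ⟨c, rfl⟩
    obtain ⟨d, rfl⟩ := hκq c
    exact ⟨algebraMap κ L d, (map_pow _ _ _).symm⟩
  have hκσ' : ∀ y, σ y ∈ (algebraMap κ L).range → y ∈ (algebraMap κ L).range := by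
    rintro y ⟨c, hc⟩
    refine hκ y (IsAlgebraic.of_pow (n := Fintype.card Fq) (by lia) ?_)
    have h1 : y ^ Fintype.card Fq = algebraMap κ L c := hc.symm
    rw [h1]
    exact isAlgebraic_algebraMap c
  let Φ := hE.sumEvalAt B
  -- This gives both `T ∩ N = 0` and, as `0 ∈ T`, the injectivity of `Φ`.
  have hΦ0 : ∀ f, Φ f ∈ T → f = 0 := fun f hf =>
    hE.eq_zero_of_sumEvalAt_mem hB _ hκσ hκσ' f ((hT _).1 hf)
  let N := LinearMap.range Φ
  have hNσ : ∀ f, Points.toField.symm (σ (Φ f).toField) ∈ N := hE.powerHom_mem_range_sumEvalAt B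
  have hNB : ∀ (e : E), ∀ b ∈ B, Points.toField.symm (e • b) ∈ N := fun e b hb =>
    hE.smul_mem_range_sumEvalAt B e hb
  have htop : T ⊔ N = ⊤ := by
    let M : AddSubgroup L := (T ⊔ N).toAddSubgroup.map (Points.toField (φ := φ) (L := L))
    have hM : M = ⊤ := by
      refine hBM M ?_ ?_ ?_
      · intro x hx
        exact ⟨Points.toField.symm x, Submodule.mem_sup_left ((hT _).2 (hV0 x hx)), rfl⟩
      · rintro _ ⟨y, hy, rfl⟩
        obtain ⟨t, ht, _, ⟨f, rfl⟩, rfl⟩ := Submodule.mem_sup.1 hy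
        refine ⟨Points.toField.symm (σ t.toField) + Points.toField.symm (σ (Φ f).toField),
          Submodule.add_mem_sup ((hT _).2 ?_) (hNσ f), ?_⟩
        · obtain ⟨c, hc⟩ := (hT t).1 ht
          exact ⟨c ^ Fintype.card Fq, by
            rw [map_pow, hc]
            rfl⟩
        · exact (map_add σ t.toField (Φ f).toField).symm
      · intro e b hb
        exact ⟨_, Submodule.mem_sup_right (hNB e b hb), rfl⟩
    refine eq_top_iff.2 fun x _ => ?_
    have h1 : x.toField ∈ M := by
      rw [hM]
      trivial
    obtain ⟨y, hy, hyx⟩ := h1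
    rw [← Points.toField.injective hyx]
    exact hy
  have hcompl : IsCompl T N := by
    refine ⟨Submodule.disjoint_def.2 ?_, codisjoint_iff.2 htop⟩
    rintro _ hx ⟨f, rfl⟩
    rw [hΦ0 f hx, map_zero]
  -- With `B` empty, `N` would vanish and every element of `L` would be constant.
  have hBne : B.Nonempty := by
    by_contra hempty
    have : IsEmpty B := Set.isEmpty_coe_sort.2 (Set.not_nonempty_iff_eq_empty.1 hempty)
    have hN : N = ⊥ := by
      refine (Submodule.eq_bot_iff _).2 ?_
      rintro _ ⟨f, rfl⟩
      rw [Subsingleton.elim f 0, map_zero]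
    rw [hN, sup_bot_eq] at htop
    obtain ⟨x, hx⟩ := hne
    refine hx ((hT (Points.toField.symm x)).1 ?_)
    rw [htop]
    trivial
  have hLinf : Infinite L := Infinite.of_injective _ (algebraMap κ L).injective
  have hBinf : B.Infinite := by
    refine hB.infinite_of_nonempty σ (fun x => ?_) hBne (Set.infinite_range_of_injective σ.injective)
    have h1 := hBM (rangeSubspace σ hσ ⊔ Submodule.span E B).toAddSubgroup
      (fun x hx => Submodule.mem_sup_left (hκσ (hV0 x hx)))
      (fun y _ => Submodule.mem_sup_left ⟨y, rfl⟩)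
      (fun e b hb => Submodule.mem_sup_right (Submodule.smul_mem _ _ (Submodule.subset_span hb)))
    have h2 : x ∈ (⊤ : AddSubgroup L) := trivial
    rw [← h1] at h2
    exact h2
  have := hBinf.to_subtype
  obtain ⟨_⟩ := nonempty_denumerable B
  obtain ⟨e⟩ := hE.nonempty_finsupp_equiv hinj
  have hker : LinearMap.ker Φ = ⊥ := by
    refine LinearMap.ker_eq_bot'.2 fun f hf => hΦ0 f ?_
    rw [hf]
    exact T.zero_mem
  let b : Module.Basis ℕ A N := ⟨(LinearEquiv.ofInjective Φ (LinearMap.ker_eq_bot.1 hker)).symm.trans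
    ((Finsupp.domLCongr (Denumerable.eqv B)).trans e)⟩
  refine ⟨N, hcompl, Module.Free.of_basis b, ?_⟩
  have h1 := b.mk_eq_rank
  rw [Cardinal.mk_nat, Cardinal.lift_aleph0] at h1
  exact Cardinal.lift_eq_aleph0.1 h1.symm

end DrinfeldModule

/-! ### Torsion points and algebraic points -/

theorem Subfield.isAlgebraic_of_finite {F K : Type*} [Field F] [Field K] [Algebra F K]
    (E : Subfield K) [Finite E] {e : K} (he : e ∈ E) : IsAlgebraic F e := by
  cases nonempty_fintype E
  refine ⟨Polynomial.X ^ Fintype.card E - Polynomial.X,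
    FiniteField.X_pow_card_sub_X_ne_zero F Fintype.one_lt_card, ?_⟩
  have h := congrArg Subtype.val (FiniteField.pow_card (⟨e, he⟩ : E))
  have h' : e ^ Fintype.card E = e := h
  simp [h']

namespace DrinfeldModule

variable {Fq A K : Type*} [Field Fq] [Fintype Fq] [CommRing A] [Algebra Fq A]
  [Field K] [Algebra Fq K] {i : A →ₐ[Fq] K} {φ : DrinfeldModule i} {E : Subfield K}

/-- If `A` were finite, it would be algebraic over `Fq`, and then every `φ_t` would be constant. -/
theorem infinite_ring (φ : DrinfeldModule i) : Infinite A := by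
  by_contra hA
  rw [not_infinite_iff_finite] at hA
  obtain ⟨t, n, hn, ht⟩ := φ.exists_coeff_ne_zero
  obtain ⟨g, hg, hg0⟩ : IsAlgebraic Fq t := (Algebra.IsIntegral.isIntegral (R := Fq) t).isAlgebraic
  refine ht (TwistedPolynomial.coeff_eq_zero_of_aeval_eq_zero hg ?_ hn)
  rw [Polynomial.aeval_algHom_apply, hg0, map_zero]

/-- The torsion points of a Drinfeld module over a finite field are the points that are algebraic
over the prime field. -/
theorem IsDefinedOver.mem_torsion_iff [IsDomain A] [Finite E] (hE : φ.IsDefinedOver E)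
    (hinj : Function.Injective φ.toAlgHom) (p : ℕ) [Fact p.Prime] [Algebra (ZMod p) K]
    {L : Type*} [Field L] [Algebra K L] [Algebra (ZMod p) L] [IsScalarTower (ZMod p) K L]
    (x : φ.Points L) :
    x ∈ Submodule.torsion A (φ.Points L) ↔ IsAlgebraic (ZMod p) x.toField := by
  have hc : ∀ e ∈ E, IsAlgebraic (ZMod p) (algebraMap K L e) := fun e he =>
    (E.isAlgebraic_of_finite he).algebraMap
  rw [Submodule.mem_torsion_iff]
  constructor
  · rintro ⟨a, ha⟩
    have ha' : TwistedPolynomial.eval L (φ.toAlgHom a) x.toField = 0 := ha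
    set f := φ.toAlgHom a with hf
    have hf0 : f ≠ 0 := fun h => nonZeroDivisors.coe_ne_zero a (hinj (h.trans (map_zero _).symm))
    obtain ⟨n, hn⟩ : ∃ n, f.coeff n ≠ 0 := by
      by_contra! h
      exact hf0 (TwistedPolynomial.ext fun n => by rw [h, TwistedPolynomial.coeff_zero])
    let κ := algebraicClosure (ZMod p) L
    let c : ℕ → κ := fun n =>
      ⟨algebraMap K L (f.coeff n), mem_algebraicClosure_iff.2 (hc _ (hE _ n))⟩
    -- The polynomial `φ_a(X)` is nonzero: the exponents `q ^ n` are distinct, so no coefficients of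
    -- `φ_a` are merged.
    have hy : IsAlgebraic κ x.toField := by
      refine ⟨∑ n ∈ f.support, Polynomial.monomial (Fintype.card Fq ^ n) (c n), ?_, ?_⟩
      · intro h
        have h1 := congrArg (fun P => Polynomial.coeff P (Fintype.card Fq ^ n)) h
        simp only [Polynomial.finsetSum_coeff, Polynomial.coeff_monomial,
          Polynomial.coeff_zero] at h1
        rw [Finset.sum_eq_single n] at h1
        · rw [if_pos rfl] at h1
          exact hn ((map_eq_zero (algebraMap K L)).1 (congrArg Subtype.val h1))
        · intro m _ hm
          exact if_neg fun h => hm (Nat.pow_right_injective Fintype.one_lt_card h)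
        · exact fun h => absurd (TwistedPolynomial.mem_support_iff.2 hn) h
      · rw [map_sum, ← ha', TwistedPolynomial.eval_apply]
        refine Finset.sum_congr rfl fun m _ => ?_
        rw [Polynomial.aeval_monomial]
        rfl
    exact hy.restrictScalars (ZMod p)
  · intro hx
    let S : Set L := insert x.toField (algebraMap K L '' (E : Set K))
    have hS : S.Finite := ((Set.toFinite (E : Set K)).image _).insert _
    -- A finite field that contains the orbit `A x`; as `A` is infinite, two of its elements act on
    -- `x` in the same way.
    let M := IntermediateField.adjoin (ZMod p) S
    have : Finite S := hS
    have : FiniteDimensional (ZMod p) M := by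
      refine IntermediateField.finiteDimensional_adjoin fun s hs => ?_
      rcases hs with rfl | ⟨e, he, rfl⟩
      · exact hx.isIntegral
      · exact (hc e he).isIntegral
    have : Finite M := Module.finite_of_finite (ZMod p)
    have hmem : ∀ a : A, (a • x).toField ∈ M := by
      intro a
      rw [Points.smul_def, TwistedPolynomial.eval_apply]
      refine sum_mem fun n _ => mul_mem ?_ (pow_mem ?_ _)
      · exact IntermediateField.subset_adjoin _ _ (Or.inr ⟨_, hE a n, rfl⟩)
      · exact IntermediateField.subset_adjoin _ _ (Or.inl rfl)
    have := φ.infinite_ring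
    obtain ⟨a, b, hab, h⟩ := Finite.exists_ne_map_eq_of_infinite
      fun a : A => (⟨(a • x).toField, hmem a⟩ : M)
    have h' : a • x = b • x := Points.toField.injective (congrArg Subtype.val h)
    exact ⟨⟨a - b, mem_nonZeroDivisors_of_ne_zero (sub_ne_zero.2 hab)⟩,
      (sub_smul a b x).trans (sub_eq_zero.2 h')⟩

end DrinfeldModule

/-! ### Countability and the compositum -/

theorem countable_of_fg {F K : Type*} [Field F] [Countable F] [Field K] [Algebra F K]
    (h : (⊤ : IntermediateField F K).FG) : Countable K := by
  obtain ⟨s, hs⟩ := h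
  have h1 := IntermediateField.lift_cardinalMk_adjoin_le F (s : Set K)
  rw [hs] at h1
  have h2 := h1.trans (max_le (max_le
    (Cardinal.lift_le_aleph0.2 Cardinal.mk_le_aleph0)
    (Cardinal.lift_le_aleph0.2 Cardinal.mk_le_aleph0)) le_rfl)
  rw [Cardinal.lift_le_aleph0, Cardinal.mk_le_aleph0_iff] at h2
  exact (IntermediateField.topEquiv (F := F) (E := K)).symm.injective.countable

section compositum

variable (p : ℕ) [Fact p.Prime] (K Ω : Type*) [Field K] [Field Ω] [Algebra K Ω]
  [Algebra (ZMod p) Ω]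

/-- The inclusion of `𝔽_p^alg` into `𝔽_p^alg K`. -/
def fpAlgInclusion : fpAlg p Ω →+* fpAlgCompositum p K Ω where
  toFun x := ⟨x, IntermediateField.subset_adjoin _ _ x.2⟩
  map_one' := rfl
  map_mul' _ _ := rfl
  map_zero' := rfl
  map_add' _ _ := rfl

theorem mem_range_fpAlgInclusion {x : fpAlgCompositum p K Ω} :
    x ∈ (fpAlgInclusion p K Ω).range ↔ (x : Ω) ∈ fpAlg p Ω :=
  ⟨by rintro ⟨y, rfl⟩; exact y.2, fun h => ⟨⟨x, h⟩, rfl⟩⟩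

variable [Algebra (ZMod p) K]

/-- Generators of `K` over `𝔽_p` also generate the compositum over `𝔽_p^alg`: it is the same field,
`M`, with the two adjunctions made in the other order. -/
theorem essFiniteType_fpAlgInclusion (hK : (⊤ : IntermediateField (ZMod p) K).FG) :
    (fpAlgInclusion p K Ω).toAlgebra.EssFiniteType := by
  let _ := (fpAlgInclusion p K Ω).toAlgebra
  obtain ⟨s, hs⟩ := hK
  let M := IntermediateField.adjoin (fpAlg p Ω) (algebraMap K Ω '' (s : Set K))
  have hKM : ∀ c : K, algebraMap K Ω c ∈ M := by
    intro c
    have hc : c ∈ (⊤ : IntermediateField (ZMod p) K) := trivial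
    rw [← hs] at hc
    induction hc using IntermediateField.adjoin_induction with
    | mem x hx => exact IntermediateField.subset_adjoin _ _ ⟨x, hx, rfl⟩
    | algebraMap x =>
      have : algebraMap K Ω (algebraMap (ZMod p) K x) = algebraMap (ZMod p) Ω x :=
        RingHom.congr_fun (Subsingleton.elim ((algebraMap K Ω).comp _) _) x
      rw [this]
      exact M.algebraMap_mem (algebraMap (ZMod p) (fpAlg p Ω) x)
    | add x y _ _ hx hy => rw [map_add]; exact add_mem hx hy
    | inv x _ hx => rw [map_inv₀]; exact inv_mem hx
    | mul x y _ _ hx hy => rw [map_mul]; exact mul_mem hx hy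
  have hLM : ∀ y ∈ fpAlgCompositum p K Ω, y ∈ M := by
    intro y hy
    induction hy using IntermediateField.adjoin_induction with
    | mem x hx => exact M.algebraMap_mem (⟨x, hx⟩ : fpAlg p Ω)
    | algebraMap x => exact hKM x
    | add x y _ _ hx hy => exact add_mem hx hy
    | inv x _ hx => exact inv_mem hx
    | mul x y _ _ hx hy => exact mul_mem hx hy
  have hML : ∀ y ∈ M, y ∈ fpAlgCompositum p K Ω := by
    intro y hy
    induction hy using IntermediateField.adjoin_induction with
    | mem x hx =>
      obtain ⟨c, _, rfl⟩ := hx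
      exact IntermediateField.algebraMap_mem _ c
    | algebraMap x => exact IntermediateField.subset_adjoin _ _ x.2
    | add x y _ _ hx hy => exact add_mem hx hy
    | inv x _ hx => exact inv_mem hx
    | mul x y _ _ hx hy => exact mul_mem hx hy
  have hM : Algebra.EssFiniteType (fpAlg p Ω) M :=
    IntermediateField.essFiniteType_iff.2
      (IntermediateField.fg_adjoin_of_finite (s.finite_toSet.image _))
  let f : M →ₐ[fpAlg p Ω] fpAlgCompositum p K Ω :=
    { toFun := fun y => ⟨y, hML y y.2⟩
      map_one' := rfl
      map_mul' := fun _ _ => rfl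
      map_zero' := rfl
      map_add' := fun _ _ => rfl
      commutes' := fun _ => rfl }
  exact Algebra.EssFiniteType.of_surjective f fun y => ⟨⟨y, hLM y y.2⟩, rfl⟩

theorem exists_notMem_fpAlg (hK : 0 < Algebra.trdeg (ZMod p) K) :
    ∃ x : fpAlgCompositum p K Ω, (x : Ω) ∉ fpAlg p Ω := by
  have : IsScalarTower (ZMod p) K Ω := .of_algebraMap_eq' (Subsingleton.elim _ _)
  by_contra! h
  have : Algebra.IsAlgebraic (ZMod p) K := by
    refine ⟨fun c => ?_⟩
    have h1 := mem_algebraicClosure_iff.1 (h (algebraMap K _ c))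
    exact (isAlgebraic_algebraMap_iff (algebraMap K Ω).injective).1 h1
  exact hK.ne' (trdeg_eq_zero)

end compositum

/-! ### The main theorem -/

theorem theoremT (p : ℕ) [Fact p.Prime]
    -- the finite field `𝔽_q`, the function field `k` of the curve `C`, and the closed point `∞`
    (Fq : Type*) [Field Fq] [Fintype Fq]
    (k : Type*) [Field k] [Algebra Fq k] (hk : IsCurveFunctionField Fq k)
    (infty : CurvePoint Fq k)
    -- the field `K` and its algebraic closure `Ω`
    (K : Type*) [Field K] [Algebra Fq K] [Algebra (ZMod p) K]
    (hKfg : (⊤ : IntermediateField (ZMod p) K).FG) (hKtr : 0 < Algebra.trdeg (ZMod p) K)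
    (Ω : Type*) [Field Ω] [Algebra K Ω] [IsAlgClosure K Ω] [Algebra (ZMod p) Ω]
    -- the Drinfeld module, defined over a finite subfield of `K`
    (i : affineRing infty →ₐ[Fq] K) (φ : DrinfeldModule i)
    (hφ : ∃ E : Subfield K, Finite E ∧ φ.IsDefinedOver E) :
    -- `𝔽_p^alg` is the set of all torsion points of `φ`
    (∀ x : φ.Points Ω,
      x ∈ Submodule.torsion (affineRing infty) (φ.Points Ω) ↔ x.toField ∈ fpAlg p Ω) ∧
    -- it is the torsion submodule of `φ(𝔽_p^alg K)`
    (∀ x : φ.Points (fpAlgCompositum p K Ω),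
      x ∈ Submodule.torsion (affineRing infty) (φ.Points (fpAlgCompositum p K Ω)) ↔
        (x.toField : Ω) ∈ fpAlg p Ω) ∧
    -- it is infinite
    Infinite (Submodule.torsion (affineRing infty) (φ.Points (fpAlgCompositum p K Ω))) ∧
    -- it has a complement that is free of rank `ℵ₀`
    ∃ N : Submodule (affineRing infty) (φ.Points (fpAlgCompositum p K Ω)),
      IsCompl (Submodule.torsion (affineRing infty) (φ.Points (fpAlgCompositum p K Ω))) N ∧
      Module.Free (affineRing infty) N ∧
      Module.rank (affineRing infty) N = ℵ₀ := by
  obtain ⟨E, hEfin, hE⟩ := hφ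
  have : IsScalarTower (ZMod p) K Ω := .of_algebraMap_eq' (Subsingleton.elim _ _)
  have hinj : Function.Injective φ.toAlgHom := φ.injective_toAlgHom fun a ha b =>
    exists_aeval_eq_mul_of_trdeg_eq_one hk.trdeg_eq_one _ ha b
  have hT : ∀ x : φ.Points (fpAlgCompositum p K Ω),
      x ∈ Submodule.torsion (affineRing infty) (φ.Points (fpAlgCompositum p K Ω)) ↔
        (x.toField : Ω) ∈ fpAlg p Ω := by
    intro x
    rw [hE.mem_torsion_iff hinj p, mem_algebraicClosure_iff]
    exact (isAlgebraic_algebraMap_iff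
      (algebraMap (fpAlgCompositum p K Ω) Ω).injective).symm
  have : IsAlgClosed Ω := IsAlgClosure.isAlgClosed K
  have hclosed : IsAlgClosed (fpAlg p Ω) := IsAlgClosure.isAlgClosed (ZMod p)
  have hinf : Infinite (fpAlg p Ω) := IsAlgClosed.instInfinite
  refine ⟨fun x => ?_, hT, ?_, ?_⟩
  · rw [hE.mem_torsion_iff hinj p, mem_algebraicClosure_iff]
  · refine Infinite.of_injective (fun c : fpAlg p Ω =>
      (⟨DrinfeldModule.Points.toField.symm (fpAlgInclusion p K Ω c), (hT _).2 c.2⟩ :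
        Submodule.torsion (affineRing infty) (φ.Points (fpAlgCompositum p K Ω)))) ?_
    intro c d h
    have h' := DrinfeldModule.Points.toField.symm.injective (congrArg Subtype.val h)
    exact (fpAlgInclusion p K Ω).injective h'
  · let _ := (fpAlgInclusion p K Ω).toAlgebra
    have := essFiniteType_fpAlgInclusion p K Ω hKfg
    have : Countable K := countable_of_fg hKfg
    have : Algebra.IsAlgebraic K Ω := IsAlgClosure.isAlgebraic
    have : Countable Ω := Set.countable_univ_iff.1
      ((Algebraic.countable K Ω).mono fun x _ => Algebra.IsAlgebraic.isAlgebraic x)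
    refine hE.exists_free_complement hinj (κ := fpAlg p Ω) ?_ ?_ ?_ hinf ?_ _ fun x =>
      (hT x).trans (mem_range_fpAlgInclusion p K Ω).symm
    · intro e
      refine (mem_range_fpAlgInclusion p K Ω).2 (mem_algebraicClosure_iff.2 ?_)
      exact (E.isAlgebraic_of_finite e.2).algebraMap
    · intro x hx
      have : IsScalarTower (fpAlg p Ω) (fpAlgCompositum p K Ω) Ω := .of_algebraMap_eq' rfl
      have hx' : IsAlgebraic (fpAlg p Ω) (x : Ω) := hx.algebraMap
      exact (mem_range_fpAlgInclusion p K Ω).2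
        (mem_algebraicClosure_iff.2 (hx'.restrictScalars (ZMod p)))
    · intro c
      exact IsAlgClosed.exists_pow_nat_eq c Fintype.card_pos
    · obtain ⟨x, hx⟩ := exists_notMem_fpAlg p K Ω hKtr
      exact ⟨x, fun h => hx ((mem_range_fpAlgInclusion p K Ω).1 h)⟩

end
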